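/- Let $L,M,S$ be positive integers with $S\le L\le M+1-S$. Let $\mu=\sum_{j=1}^S x_j\delta_{\omega_j}$ with nonzero amplitudes $x_j\in\mathbb{C}$ and pairwise distinct points $\omega_j\in\mathbb{T}=\mathbb{R}/\mathbb{Z}$; put $\Omega=\{\omega_j\}_{j=1}^S$, $x_{\min}=\min_j|x_j|$ and $\Delta=\min_{j\ne k}|\omega_j-\omega_k|_{\mathbb{T}}$, where $|t|_{\mathbb{T}}=\min_{n\in\mathbb{Z}}|t-n|$ (and $\Delta=+\infty$ if $S=1$). Let $y^0\in\mathbb{C}^{M+1}$ be given by $y^0_k=\sum_{j=1}^S x_je^{-2\pi ik\omega_j}$, $0\le k\le M$, let $\eta\in\mathbb{C}^{M+1}$ be arbitrary, and let $y=y^0+\eta$. Notation. For $z\in\mathbb{C}^{M+1}$ let $\mathcal{H}(z)=(z_{i+j})_{0\le i\le L,\ 0\le j\le M-L}$ be its Hankel matrix. Let $\Phi_N=(e^{-2\pi ik\omega_j})_{0\le k\le N,\ 1\le j\le S}$. Let $\|\cdot\|_2$ be the spectral norm, $\sigma_S(\cdot)$ the $S$-th largest singular value, and $A^\dagger$ the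 Moore–Penrose pseudoinverse. Let the columns of $U\in\mathbb{C}^{(L+1)\times S}$ be the first $S$ left singular vectors in any singular value decomposition (singular values in decreasing order) of $\mathcal{H}(y^0)$, and let $U_0$ be the first $L$ rows of $U$. ESPRIT. Let the columns of $\hat U\in\mathbb{C}^{(L+1)\times S}$ be the first $S$ left singular vectors in any singular value decomposition (singular values in decreasing order) of $\mathcal{H}(y)$. Let $\hat U_0$ and $\hat U_1$ be the first and the last $L$ rows of $\hat U$. Let $\hat\lambda_1,\dots,\hat\lambda_S$ be the eigenvalues of $\hat U_0^\dagger\hat U_1$, listed with algebraic multiplicity. The output is $\hat\Omega=\{\hat\omega_j\}_{j=1}^S$ with $\hat\omega_j=-\arg(\hat\lambda_j)/(2\pi)\in\mathbb{T}$ (with $\arg 0=0$). The matching distance is $\mathrm{md}(\Omega,\hat\Omega)=\min_\psi\max_j|\hat\omega_{\psi(j)}-\omega_j|_{\mathbb{T}}$, the minimum being over all permutations $\psi$ of $\{1,\dots,S\}$. Then the following hold. (a) (Moderate noise) If $$\|\mathcal{H}(\eta)\|_2\le\frac{x_{\min}\,\sigma_S(U_0)\,\sigma_S(\Phi_L)\,\sigma_S(\Phi_{M-L})}{4\sqrt{2S}},$$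 then $$\mathrm{md}(\Omega,\hat\Omega)\le\frac{20\,S^2\sqrt{L+1}\,\|\mathcal{H}(\eta)\|_2}{x_{\min}\,\sigma_S^2(U_0)\,\sigma_S^2(\Phi_L)\,\sigma_S(\Phi_{M-L})}.$$ (b) (Small noise) If $$\|\mathcal{H}(\eta)\|_2\le\frac{x_{\min}\,\Delta\,\sigma_S^2(U_0)\,\sigma_S^3(\Phi_L)\,\sigma_S(\Phi_{M-L})}{20\,S^{5/2}(L+1)},$$ then $$\mathrm{md}(\Omega,\hat\Omega)\le\frac{20\sqrt{S}\,\|\mathcal{H}(\eta)\|_2}{x_{\min}\,\sigma_S^2(U_0)\,\sigma_S(\Phi_L)\,\sigma_S(\Phi_{M-L})}.$$ -/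

import Mathlib

noncomputable section

namespace ESPRIT

open Matrix

/-- `σ_k(A)`: the `k`-th largest singular value of a complex matrix, `k = 1, 2, …`
(the singular values in Mathlib are indexed from `0`). -/
def sv {m n : ℕ} (k : ℕ) (A : Matrix (Fin m) (Fin n) ℂ) : ℝ :=
  (Matrix.toEuclideanLin A).singularValues (k - 1)

/-- `‖A‖₂`: the spectral norm, i.e. the operator norm between Euclidean spaces. -/
def specNorm {m n : ℕ} (A : Matrix (Fin m) (Fin n) ℂ) : ℝ :=
  ‖LinearMap.toContinuousLinearMap (Matrix.toEuclideanLin A)‖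

/-- The Vandermonde matrix `Φ_N` with `N + 1` rows: its entry in row `k = 0, …, N` and
column `j` is `exp(-2πi k ω_j)`. -/
def vandermonde {S : ℕ} (N : ℕ) (ω : Fin S → UnitAddCircle) : Matrix (Fin (N + 1)) (Fin S) ℂ :=
  Matrix.of fun k j => fourier (-((k : ℕ) : ℤ)) (ω j)

/-- The first `M + 1` Fourier coefficients of `μ = ∑ j, x_j δ_{ω_j}`. -/
def samples {S : ℕ} (M : ℕ) (x : Fin S → ℂ) (ω : Fin S → UnitAddCircle) : Fin (M + 1) → ℂ :=
  fun k => ∑ j, x j * fourier (-((k : ℕ) : ℤ)) (ω j)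

/-- The `(L+1) × (M-L+1)` Hankel matrix with entries `y_{i+j}`. For `L ≤ M` the index satisfies
`i + j ≤ M`, so that `Fin.ofNat` does not reduce it. -/
def hankel {M : ℕ} (L : ℕ) (y : Fin (M + 1) → ℂ) : Matrix (Fin (L + 1)) (Fin (M - L + 1)) ℂ :=
  Matrix.of fun i j => y (Fin.ofNat (M + 1) ((i : ℕ) + (j : ℕ)))

/-- `A = W Σ Vᴴ` is a singular value decomposition: `W` and `V` are unitary, and `Σ` is the
rectangular diagonal matrix with diagonal `s 0 ≥ s 1 ≥ … ≥ 0`. -/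
structure IsSVD {m n : ℕ} (A : Matrix (Fin m) (Fin n) ℂ) (W : Matrix (Fin m) (Fin m) ℂ)
    (s : ℕ → ℝ) (V : Matrix (Fin n) (Fin n) ℂ) : Prop where
  left_unitary : W ∈ Matrix.unitaryGroup (Fin m) ℂ
  right_unitary : V ∈ Matrix.unitaryGroup (Fin n) ℂ
  nonneg : ∀ i, 0 ≤ s i
  antitone : Antitone s
  eq_mul : A = W * (Matrix.of fun (i : Fin m) (j : Fin n) =>
    if (i : ℕ) = (j : ℕ) then ((s i : ℝ) : ℂ) else 0) * Vᴴ

/-- `U` consists of the first `S` left singular vectors in some singular value decomposition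
of `A`. -/
def IsLeadingLeftSingular {m n S : ℕ} (A : Matrix (Fin m) (Fin n) ℂ)
    (U : Matrix (Fin m) (Fin S) ℂ) : Prop :=
  ∃ (h : S ≤ m) (W : Matrix (Fin m) (Fin m) ℂ) (s : ℕ → ℝ) (V : Matrix (Fin n) (Fin n) ℂ),
    IsSVD A W s V ∧ U = W.submatrix id (Fin.castLE h)

/-- `U₀`: the first `L` rows of a matrix with `L + 1` rows. -/
def firstRows {L S : ℕ} (U : Matrix (Fin (L + 1)) (Fin S) ℂ) : Matrix (Fin L) (Fin S) ℂ :=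
  U.submatrix Fin.castSucc id

/-- `U₁`: the last `L` rows of a matrix with `L + 1` rows. -/
def lastRows {L S : ℕ} (U : Matrix (Fin (L + 1)) (Fin S) ℂ) : Matrix (Fin L) (Fin S) ℂ :=
  U.submatrix Fin.succ id

/-- The Moore–Penrose pseudoinverse `A† = (AᴴA)† Aᴴ`, where the pseudoinverse of the Hermitian
matrix `AᴴA` is given by functional calculus: every nonzero eigenvalue is inverted and the
eigenvalue `0` is kept (`0⁻¹ = 0`). The four Penrose equations are proved below. -/
def pinv {m n : ℕ} (A : Matrix (Fin m) (Fin n) ℂ) : Matrix (Fin n) (Fin m) ℂ :=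
  cfc (fun t : ℝ => t⁻¹) (Aᴴ * A) * Aᴴ

section Penrose

variable {m n : ℕ} (A : Matrix (Fin m) (Fin n) ℂ)

theorem gram_isSelfAdjoint : IsSelfAdjoint (Aᴴ * A) :=
  Matrix.isHermitian_conjTranspose_mul_self A

theorem cont_on_spectrum (f : ℝ → ℝ) : ContinuousOn f (spectrum ℝ (Aᴴ * A)) :=
  (Matrix.finite_real_spectrum (A := Aᴴ * A)).continuousOn f

theorem pinv_mul_self_eq : pinv A * A = cfc (fun t : ℝ => t⁻¹ * t) (Aᴴ * A) := by
  have h := gram_isSelfAdjoint A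
  rw [cfc_mul (fun t : ℝ => t⁻¹) (fun t => t) (Aᴴ * A) (cont_on_spectrum A _)
    (cont_on_spectrum A _), cfc_id' ℝ (Aᴴ * A) h, pinv, Matrix.mul_assoc]

theorem gram_mul_pinv_mul : Aᴴ * A * (pinv A * A) = Aᴴ * A := by
  have h := gram_isSelfAdjoint A
  have e : cfc (fun t : ℝ => t * (t⁻¹ * t)) (Aᴴ * A) = Aᴴ * A := by
    have : (fun t : ℝ => t * (t⁻¹ * t)) = fun t => t := by
      funext t
      by_cases ht : t = 0
      · simp [ht]
      · field_simp
    rw [this, cfc_id' ℝ (Aᴴ * A) h]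
  rw [cfc_mul (fun t : ℝ => t) (fun t => t⁻¹ * t) (Aᴴ * A) (cont_on_spectrum A _)
    (cont_on_spectrum A _), cfc_id' ℝ (Aᴴ * A) h] at e
  rw [pinv_mul_self_eq, e]

theorem isHermitian_pinv_mul_self : (pinv A * A).IsHermitian := by
  rw [pinv_mul_self_eq]
  exact IsSelfAdjoint.cfc

open scoped ComplexOrder in
theorem mul_pinv_mul_self : A * pinv A * A = A := by
  have h1 : Aᴴ * A * (pinv A * A - 1) = 0 := by
    rw [Matrix.mul_sub, gram_mul_pinv_mul, Matrix.mul_one, sub_self]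
  have h2 : A * (pinv A * A - 1) = 0 := by
    rw [← Matrix.conjTranspose_mul_self_mul_eq_zero]
    exact h1
  rw [Matrix.mul_sub, Matrix.mul_one, sub_eq_zero] at h2
  rw [Matrix.mul_assoc, h2]

theorem pinv_mul_self_mul_pinv : pinv A * A * pinv A = pinv A := by
  have h : cfc (fun t : ℝ => t⁻¹ * t) (Aᴴ * A) * cfc (fun t : ℝ => t⁻¹) (Aᴴ * A)
      = cfc (fun t : ℝ => t⁻¹) (Aᴴ * A) := by
    rw [← cfc_mul (fun t : ℝ => t⁻¹ * t) (fun t => t⁻¹) (Aᴴ * A) (cont_on_spectrum A _)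
      (cont_on_spectrum A _)]
    congr 1
    funext t
    by_cases ht : t = 0
    · simp [ht]
    · field_simp
  rw [pinv_mul_self_eq]
  conv_lhs => rw [pinv]
  rw [← Matrix.mul_assoc, h, pinv]

theorem isHermitian_mul_pinv : (A * pinv A).IsHermitian := by
  have hs : (cfc (fun t : ℝ => t⁻¹) (Aᴴ * A))ᴴ = cfc (fun t : ℝ => t⁻¹) (Aᴴ * A) :=
    (IsSelfAdjoint.cfc : IsSelfAdjoint (cfc (fun t : ℝ => t⁻¹) (Aᴴ * A)))
  rw [Matrix.IsHermitian, pinv, Matrix.conjTranspose_mul, Matrix.conjTranspose_mul,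
    Matrix.conjTranspose_conjTranspose, hs, Matrix.mul_assoc]

end Penrose

/-- `ωhat` is an output of the ESPRIT algorithm with input data `y`, sparsity `S` and Hankel
parameter `L`: take the first `S` left singular vectors `U` in any singular value decomposition
of the Hankel matrix of `y`, list the `S` eigenvalues of `U₀† U₁` with algebraic multiplicity in
any order, and return their angles divided by `-2π`, as points of the circle `ℝ/ℤ`. -/
def IsOutput {M S : ℕ} (L : ℕ) (y : Fin (M + 1) → ℂ) (ωhat : Fin S → UnitAddCircle) : Prop :=
  ∃ (U : Matrix (Fin (L + 1)) (Fin S) ℂ) (ev : Fin S → ℂ),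
    IsLeadingLeftSingular (hankel L y) U ∧
    (pinv (firstRows U) * lastRows U).charpoly.roots = Finset.univ.val.map ev ∧
    ∀ j, ωhat j = ((-(ev j).arg / (2 * Real.pi) : ℝ) : UnitAddCircle)

/-- The matching distance: the minimum over permutations `ψ` of the maximum over `j` of
`|ωhat_{ψ(j)} - ω_j|` (distance on the circle `ℝ/ℤ`). -/
def matchingDist {S : ℕ} (ω ωhat : Fin S → UnitAddCircle) : ℝ :=
  ⨅ ψ : Equiv.Perm (Fin S), ⨆ j, dist (ωhat (ψ j)) (ω j)

/-- The minimum separation `Δ = min_{j ≠ k} |ω_j - ω_k|` on the circle `ℝ/ℤ`; it is `∞` if there is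
only one point. -/
def minSep {S : ℕ} (ω : Fin S → UnitAddCircle) : ENNReal :=
  Set.einfsep (Set.range ω)

/-- `x_min = min_j |x_j|`. -/
def minAmp {S : ℕ} (x : Fin S → ℂ) : ℝ :=
  ⨅ j, ‖x j‖

end ESPRIT

end

noncomputable section

namespace ESPRIT

open Matrix

/-! Write F = Φ_L and λ_j = e^{-2πiω_j}. The noiseless Hankel matrix factors as F B with B = diag(x)
Φ_{M-L}ᵀ, and B has a right inverse of norm at most 1/(x_min σ_S(Φ_{M-L})). The last rows of F are
its first rows times diag(λ), so an exact basis of range F would give a matrix similar to diag(λ).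

With noise N, Weyl's inequality bounds the part of F B + N outside the range of Û by ‖N‖. Undoing B,
the range of F lies close to that of Û (`IsLeadingLeftSingular.en_sub_proj_factor_le`). Hence Q = Ûᴴ
F is invertible, and conjugating Û₀† Û₁ by Q gives diag(λ) + E with ‖E‖ ≤ r = 16‖N‖ / (x_min
σ_S(Φ_L) σ_S(Φ_{M-L}) σ_S(U₀)) (`exists_charpoly_pinv_mul_eq`). No subspace alignment between U and
Û is needed: U enters only through the lower bound σ_S(U₀) for passing to the first rows on range F.

As diag(λ) is normal, every eigenvalue of diag(λ) + tE lies within r of some λ_i (Bauer–Fike), and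
following t from 0 to 1 shows that each connected cluster of discs keeps its number of eigenvalues
(`exists_perm_eigenvalues`). A cluster chains at most S discs, so matched points differ by at most
(2S-1)r; angles cost a factor 1/2 (`dist_arg_le`). This gives (a). In (b) the separation makes the
discs disjoint, so the error is r/2; if the noise is too large for the perturbation argument, the
claimed bound exceeds the trivial 1/2. -/

/-! ### Euclidean norms, isometries and orthogonal projections. -/

/-- The Euclidean norm of a vector given as a function. -/
def en {n : ℕ} (v : Fin n → ℂ) : ℝ := ‖(WithLp.toLp 2 v : EuclideanSpace ℂ (Fin n))‖

theorem en_nonneg {n : ℕ} (v : Fin n → ℂ) : 0 ≤ en v := norm_nonneg _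

theorem en_sq {n : ℕ} (v : Fin n → ℂ) : en v ^ 2 = ∑ i, ‖v i‖ ^ 2 := by
  simp [en, EuclideanSpace.norm_sq_eq]

theorem en_eq_zero {n : ℕ} {v : Fin n → ℂ} : en v = 0 ↔ v = 0 := by
  simp [en]

theorem en_pos {n : ℕ} {v : Fin n → ℂ} (h : v ≠ 0) : 0 < en v :=
  lt_of_le_of_ne (en_nonneg v) fun h' => h (en_eq_zero.1 h'.symm)

theorem en_add_le {n : ℕ} (v w : Fin n → ℂ) : en (v + w) ≤ en v + en w := by
  simpa [en] using norm_add_le (WithLp.toLp 2 v : EuclideanSpace ℂ (Fin n)) (WithLp.toLp 2 w)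

theorem en_sub_le {n : ℕ} (v w : Fin n → ℂ) : en (v - w) ≤ en v + en w := by
  simpa [en] using norm_sub_le (WithLp.toLp 2 v : EuclideanSpace ℂ (Fin n)) (WithLp.toLp 2 w)

theorem en_smul {n : ℕ} (c : ℂ) (v : Fin n → ℂ) : en (c • v) = ‖c‖ * en v := by
  simpa [en] using norm_smul c (WithLp.toLp 2 v : EuclideanSpace ℂ (Fin n))

theorem en_star {n : ℕ} (v : Fin n → ℂ) : en (star v) = en v := by
  rw [← sq_eq_sq₀ (en_nonneg _) (en_nonneg _), en_sq, en_sq]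
  simp

theorem star_dotProduct_self_eq {n : ℕ} (v : Fin n → ℂ) : star v ⬝ᵥ v = ((en v ^ 2 : ℝ) : ℂ) := by
  rw [en_sq]
  simp [dotProduct, Complex.conj_mul']

theorem norm_star_dotProduct_le {n : ℕ} (v w : Fin n → ℂ) : ‖star v ⬝ᵥ w‖ ≤ en v * en w := by
  have h := norm_inner_le_norm (𝕜 := ℂ) (WithLp.toLp 2 v : EuclideanSpace ℂ (Fin n))
    (WithLp.toLp 2 w)
  rw [EuclideanSpace.inner_eq_star_dotProduct] at h
  rwa [dotProduct_comm]

theorem star_mulVec_dotProduct {m n : ℕ} (A : Matrix (Fin m) (Fin n) ℂ) (v : Fin n → ℂ)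
    (w : Fin m → ℂ) : star (A *ᵥ v) ⬝ᵥ w = star v ⬝ᵥ (Aᴴ *ᵥ w) := by
  rw [star_mulVec, dotProduct_mulVec]

theorem sum_comp_le_of_injective {p m : ℕ} {f : Fin p → Fin m} (hf : Function.Injective f)
    (g : Fin m → ℝ) (hg : ∀ i, 0 ≤ g i) : ∑ k, g (f k) ≤ ∑ i, g i := by
  rw [← Finset.sum_image (f := g) (s := Finset.univ) (g := f) fun _ _ _ _ h => hf h]
  exact Finset.sum_le_sum_of_subset_of_nonneg (Finset.subset_univ _) fun i _ _ => hg i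

theorem en_comp_le {p m : ℕ} {f : Fin p → Fin m} (hf : Function.Injective f) (v : Fin m → ℂ) :
    en (v ∘ f) ≤ en v := by
  refine le_of_sq_le_sq ?_ (en_nonneg _)
  rw [en_sq, en_sq]
  exact sum_comp_le_of_injective hf (fun i => ‖v i‖ ^ 2) fun i => by positivity

theorem en_mulVec_le {m n : ℕ} (A : Matrix (Fin m) (Fin n) ℂ) (v : Fin n → ℂ) :
    en (A *ᵥ v) ≤ specNorm A * en v :=
  (LinearMap.toContinuousLinearMap (Matrix.toEuclideanLin A)).le_opNorm
    (WithLp.toLp 2 v : EuclideanSpace ℂ (Fin n))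

theorem specNorm_nonneg {m n : ℕ} (A : Matrix (Fin m) (Fin n) ℂ) : 0 ≤ specNorm A :=
  norm_nonneg _

theorem en_isometry_mulVec {m n : ℕ} {A : Matrix (Fin m) (Fin n) ℂ} (h : Aᴴ * A = 1)
    (v : Fin n → ℂ) : en (A *ᵥ v) = en v := by
  have e : ((en (A *ᵥ v) ^ 2 : ℝ) : ℂ) = ((en v ^ 2 : ℝ) : ℂ) := by
    rw [← star_dotProduct_self_eq, star_mulVec_dotProduct, mulVec_mulVec, h, one_mulVec,
      star_dotProduct_self_eq]
  exact (sq_eq_sq₀ (en_nonneg _) (en_nonneg _)).1 (Complex.ofReal_injective e)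

theorem en_sub_proj_sq {m n : ℕ} {U : Matrix (Fin m) (Fin n) ℂ} (h : Uᴴ * U = 1)
    (v : Fin m → ℂ) :
    en (v - U *ᵥ (Uᴴ *ᵥ v)) ^ 2 = en v ^ 2 - en (Uᴴ *ᵥ v) ^ 2 := by
  apply Complex.ofReal_injective
  push_cast
  have key (u : Fin m → ℂ) : star (U *ᵥ (Uᴴ *ᵥ v)) ⬝ᵥ u = star (Uᴴ *ᵥ v) ⬝ᵥ (Uᴴ *ᵥ u) :=
    star_mulVec_dotProduct _ _ _
  have h0 (u : Fin m → ℂ) : star u ⬝ᵥ U *ᵥ (Uᴴ *ᵥ v) = star (Uᴴ *ᵥ u) ⬝ᵥ (Uᴴ *ᵥ v) := by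
    rw [star_mulVec_dotProduct, conjTranspose_conjTranspose]
  have e := star_dotProduct_self_eq (v - U *ᵥ (Uᴴ *ᵥ v))
  have e1 := star_dotProduct_self_eq v
  have e2 := star_dotProduct_self_eq (Uᴴ *ᵥ v)
  push_cast at e e1 e2
  rw [← e, ← e1, ← e2, star_sub, sub_dotProduct, key, mulVec_sub, mulVec_mulVec _ Uᴴ U, h,
    one_mulVec, sub_self, dotProduct_zero, sub_zero, dotProduct_sub, h0]

theorem en_sub_proj_le {m n : ℕ} {U : Matrix (Fin m) (Fin n) ℂ} (h : Uᴴ * U = 1)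
    (v : Fin m → ℂ) : en (v - U *ᵥ (Uᴴ *ᵥ v)) ≤ en v := by
  refine le_of_sq_le_sq ?_ (en_nonneg _)
  rw [en_sub_proj_sq h]
  linarith [sq_nonneg (en (Uᴴ *ᵥ v))]

theorem en_conjTranspose_isometry_mulVec_le {m n : ℕ} {U : Matrix (Fin m) (Fin n) ℂ}
    (h : Uᴴ * U = 1) (v : Fin m → ℂ) : en (Uᴴ *ᵥ v) ≤ en v := by
  refine le_of_sq_le_sq ?_ (en_nonneg _)
  linarith [en_sub_proj_sq h v, sq_nonneg (en (v - U *ᵥ (Uᴴ *ᵥ v)))]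

/-! ### The smallest singular value as a lower bound. -/

/-- Expand in an eigenbasis of the Gram operator: with S columns, index S - 1 is the last, so its
eigenvalue σ_S² is the least. -/
theorem sv_mul_en_le {m S : ℕ} (hS : 1 ≤ S) (A : Matrix (Fin m) (Fin S) ℂ) (v : Fin S → ℂ) :
    sv S A * en v ≤ en (A *ᵥ v) := by
  set T := Matrix.toEuclideanLin A with hT
  set x : EuclideanSpace ℂ (Fin S) := WithLp.toLp 2 v with hx
  have hfin : Module.finrank ℂ (EuclideanSpace ℂ (Fin S)) = S := by simp
  have hs := T.isSymmetric_adjoint_comp_self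
  set b := hs.eigenvectorBasis hfin with hb
  have hTx : ‖T x‖ ^ 2 = ∑ i, hs.eigenvalues hfin i * ‖inner ℂ (b i) x‖ ^ 2 := by
    have e1 : inner ℂ x ((LinearMap.adjoint T ∘ₗ T) x) = ((‖T x‖ ^ 2 : ℝ) : ℂ) := by
      rw [LinearMap.comp_apply, LinearMap.adjoint_inner_right, inner_self_eq_norm_sq_to_K]
      push_cast
      rfl
    have e2 : inner ℂ x ((LinearMap.adjoint T ∘ₗ T) x)
        = ((∑ i, hs.eigenvalues hfin i * ‖inner ℂ (b i) x‖ ^ 2 : ℝ) : ℂ) := by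
      rw [← b.sum_inner_mul_inner]
      simp only [Complex.ofReal_sum, Complex.ofReal_mul, Complex.ofReal_pow]
      refine Finset.sum_congr rfl fun i _ => ?_
      rw [← hs (b i) x, hb, hs.apply_eigenvectorBasis, inner_smul_left,
        ← inner_conj_symm x, mul_left_comm, Complex.conj_mul']
      simp
    exact Complex.ofReal_injective (e1.symm.trans e2)
  have hxx : ‖x‖ ^ 2 = ∑ i, ‖inner ℂ (b i) x‖ ^ 2 := (b.sum_sq_norm_inner_right x).symm
  have hsv : sv S A ^ 2 = hs.eigenvalues hfin ⟨S - 1, by omega⟩ :=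
    T.sq_singularValues_of_lt hfin (by omega)
  refine le_of_sq_le_sq ?_ (en_nonneg _)
  change (sv S A * ‖x‖) ^ 2 ≤ ‖T x‖ ^ 2
  rw [mul_pow, hTx, hxx, hsv, Finset.mul_sum]
  refine Finset.sum_le_sum fun i _ => mul_le_mul_of_nonneg_right ?_ (by positivity)
  exact hs.eigenvalues_antitone hfin (Fin.le_def.2 (by simp; omega))

theorem sv_pos {m S : ℕ} (hS : 1 ≤ S) (A : Matrix (Fin m) (Fin S) ℂ)
    (h : ∀ v, A *ᵥ v = 0 → v = 0) : 0 < sv S A := by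
  refine (LinearMap.injective_iff_forall_lt_finrank_singularValues_pos _).1 ?_ (S - 1)
    (by simp; omega)
  rw [injective_iff_map_eq_zero]
  intro x hx
  have := h x.ofLp (by simpa [Matrix.toLpLin_apply] using hx)
  simpa using this

/-- A matrix bounded below by `σ` has an adjoint with a right inverse bounded by `1 / σ`. -/
theorem exists_conjTranspose_mulVec_eq {m S : ℕ} (A : Matrix (Fin m) (Fin S) ℂ) {σ : ℝ}
    (hσ : 0 < σ) (h : ∀ v, σ * en v ≤ en (A *ᵥ v)) (c : Fin S → ℂ) :
    ∃ w, Aᴴ *ᵥ w = c ∧ σ * en w ≤ en c := by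
  have hinj : Function.Injective (Aᴴ * A).mulVec := by
    rw [← Matrix.coe_mulVecLin, injective_iff_map_eq_zero]
    intro v hv
    have hv' : Aᴴ *ᵥ (A *ᵥ v) = 0 := by simpa using hv
    have h2 : en (A *ᵥ v) = 0 := by
      have := star_dotProduct_self_eq (A *ᵥ v)
      rw [star_mulVec_dotProduct, hv', dotProduct_zero] at this
      exact_mod_cast pow_eq_zero_iff (two_ne_zero) |>.1 (Complex.ofReal_injective this.symm)
    have := h v
    rw [h2] at this
    exact en_eq_zero.1 (le_antisymm (nonpos_of_mul_nonpos_right this hσ) (en_nonneg v))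
  have hsurj : Function.Surjective (Aᴴ * A).mulVec := by
    rw [← Matrix.coe_mulVecLin] at hinj ⊢
    exact LinearMap.injective_iff_surjective.1 hinj
  obtain ⟨a, ha⟩ := hsurj c
  have ha' : Aᴴ *ᵥ (A *ᵥ a) = c := by rw [mulVec_mulVec]; exact ha
  refine ⟨A *ᵥ a, ha', ?_⟩
  have h1 : en (A *ᵥ a) ^ 2 ≤ en a * en c := by
    have := star_dotProduct_self_eq (A *ᵥ a)
    rw [star_mulVec_dotProduct, ha'] at this
    have h3 := norm_star_dotProduct_le a c
    rwa [this, Complex.norm_real, Real.norm_of_nonneg (by positivity)] at h3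
  rcases (en_nonneg (A *ᵥ a)).eq_or_lt with h0 | h0
  · rw [← h0, mul_zero]; exact en_nonneg c
  · refine le_of_mul_le_mul_right ?_ h0
    nlinarith [h a, en_nonneg c, en_nonneg a]

/-! ### Leading singular vectors of a perturbed matrix of rank at most S. -/

/-- The columns of a leading left singular matrix are orthonormal. -/
theorem IsLeadingLeftSingular.conjTranspose_mul_self {m n S : ℕ} {A : Matrix (Fin m) (Fin n) ℂ}
    {U : Matrix (Fin m) (Fin S) ℂ} (h : IsLeadingLeftSingular A U) : Uᴴ * U = 1 := by
  obtain ⟨hm, W, s, V, hW, rfl⟩ := h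
  have h1 : Wᴴ * W = 1 := (Matrix.mem_unitaryGroup_iff'.1 hW.left_unitary)
  ext i j
  have := congrFun (congrFun h1 (Fin.castLE hm i)) (Fin.castLE hm j)
  simp only [mul_apply, conjTranspose_apply, submatrix_apply, id_eq] at this ⊢
  rw [this]
  simp [Matrix.one_apply]

theorem rectDiagonal_mulVec {m n : ℕ} (s : ℕ → ℝ) (u : Fin n → ℂ) (i : Fin m) :
    ((Matrix.of fun (i : Fin m) (j : Fin n) => if (i : ℕ) = (j : ℕ) then ((s i : ℝ) : ℂ) else 0)
      *ᵥ u) i = if h : (i : ℕ) < n then (s i : ℂ) * u ⟨i, h⟩ else 0 := by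
  simp only [mulVec, dotProduct, of_apply, ite_mul, zero_mul]
  split_ifs with h
  · rw [Finset.sum_eq_single (⟨i, h⟩ : Fin n)]
    · simp
    · intro j _ hj
      rw [if_neg]
      intro h'
      exact hj (Fin.ext h'.symm)
    · simp
  · refine Finset.sum_eq_zero fun j _ => if_neg ?_
    have := j.2
    omega

/-- Weyl's inequality for a perturbation of a matrix that factors through `ℂ^S`. -/
theorem IsSVD.le_specNorm {m n S : ℕ} {A N : Matrix (Fin m) (Fin n) ℂ}
    {F : Matrix (Fin m) (Fin S) ℂ} {B : Matrix (Fin S) (Fin n) ℂ} (hA : A = F * B + N)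
    {W : Matrix (Fin m) (Fin m) ℂ} {s : ℕ → ℝ} {V : Matrix (Fin n) (Fin n) ℂ}
    (h : IsSVD A W s V) {k : ℕ} (hk : S ≤ k) (hm : k < m) (hn : k < n) : s k ≤ specNorm N := by
  have hm' : S + 1 ≤ m := by omega
  have hn' : S + 1 ≤ n := by omega
  have hW : Wᴴ * W = 1 := Matrix.mem_unitaryGroup_iff'.1 h.left_unitary
  have hV : Vᴴ * V = 1 := Matrix.mem_unitaryGroup_iff'.1 h.right_unitary
  set I : Matrix (Fin n) (Fin (S + 1)) ℂ := (1 : Matrix (Fin n) (Fin n) ℂ).submatrix id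
    (Fin.castLE hn') with hI
  have hII : Iᴴ * I = 1 := by
    ext i j
    simp [hI, mul_apply, one_apply]
  -- Dimension count: the span of the first S + 1 right singular vectors meets the kernel of B,
  -- where the matrix acts as N; on that span it stretches by at least s_S ≥ s_k.
  obtain ⟨a, ha, ha0⟩ : ∃ a : Fin (S + 1) → ℂ, B *ᵥ (V *ᵥ (I *ᵥ a)) = 0 ∧ a ≠ 0 := by
    have := LinearMap.ker_ne_bot_of_finrank_lt (f := (B * V * I).mulVecLin) (by simp)
    obtain ⟨a, ha, ha0⟩ := Submodule.exists_mem_ne_zero_of_ne_bot this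
    refine ⟨a, ?_, ha0⟩
    simpa [mul_assoc] using ha
  have hAv : A *ᵥ (V *ᵥ (I *ᵥ a)) = N *ᵥ (V *ᵥ (I *ᵥ a)) := by
    rw [hA, add_mulVec, ← mulVec_mulVec, ha, mulVec_zero, zero_add]
  have hle : en (A *ᵥ (V *ᵥ (I *ᵥ a))) ≤ specNorm N * en a := by
    rw [hAv]
    refine (en_mulVec_le _ _).trans_eq ?_
    rw [en_isometry_mulVec hV, en_isometry_mulVec hII]
  have hIa (j : Fin (S + 1)) : (I *ᵥ a) (Fin.castLE hn' j) = a j := by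
    simp [hI, mulVec, dotProduct, one_apply]
  have hge : s k * en a ≤ en (A *ᵥ (V *ᵥ (I *ᵥ a))) := by
    rw [h.eq_mul, ← mulVec_mulVec, ← mulVec_mulVec, mulVec_mulVec _ Vᴴ V, hV, one_mulVec,
      en_isometry_mulVec hW]
    refine le_trans ?_ (en_comp_le (Fin.castLE_injective hm') _)
    refine le_of_sq_le_sq ?_ (en_nonneg _)
    rw [mul_pow, en_sq, en_sq, Finset.mul_sum]
    refine Finset.sum_le_sum fun j _ => ?_
    have hj : ((Fin.castLE hm' j : Fin m) : ℕ) < n := by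
      simp; omega
    rw [Function.comp_apply, rectDiagonal_mulVec, dif_pos hj]
    have e : (⟨((Fin.castLE hm' j : Fin m) : ℕ), hj⟩ : Fin n) = Fin.castLE hn' j := rfl
    rw [e, hIa, norm_mul, mul_pow, Complex.norm_real, Real.norm_of_nonneg (h.nonneg _)]
    refine mul_le_mul_of_nonneg_right ?_ (by positivity)
    refine pow_le_pow_left₀ (h.nonneg _) (h.antitone ?_) 2
    simp; omega
  exact le_of_mul_le_mul_right (hge.trans hle) (en_pos ha0)

/-- The part of a perturbed rank-`S` matrix outside its leading left singular space. -/
theorem IsLeadingLeftSingular.en_residual_le {m n S : ℕ} {A N : Matrix (Fin m) (Fin n) ℂ}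
    {F : Matrix (Fin m) (Fin S) ℂ} {B : Matrix (Fin S) (Fin n) ℂ} (hA : A = F * B + N)
    {U : Matrix (Fin m) (Fin S) ℂ} (h : IsLeadingLeftSingular A U) (v : Fin n → ℂ) :
    en (A *ᵥ v - U *ᵥ (Uᴴ *ᵥ (A *ᵥ v))) ≤ specNorm N * en v := by
  obtain ⟨hm, W, s, V, hW, rfl⟩ := h
  have hs {k : ℕ} (hk : S ≤ k) (hkm : k < m) (hkn : k < n) := hW.le_specNorm hA hk hkm hkn
  have hWW : Wᴴ * W = 1 := Matrix.mem_unitaryGroup_iff'.1 hW.left_unitary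
  have hVV : V * Vᴴ = 1 := Matrix.mem_unitaryGroup_iff.1 hW.right_unitary
  set u := Vᴴ *ᵥ v with hu
  have hun : en u = en v := en_isometry_mulVec (by simpa using hVV) v
  set D := (Matrix.of fun (i : Fin m) (j : Fin n) =>
    if (i : ℕ) = (j : ℕ) then ((s i : ℝ) : ℂ) else 0) with hD
  have hAv : A *ᵥ v = W *ᵥ (D *ᵥ u) := by
    rw [hW.eq_mul, ← mulVec_mulVec, ← mulVec_mulVec]
  -- In the coordinates of W, projecting onto its first S columns is truncation, so the residual
  -- involves only the s_i with i ≥ S.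
  have hproj (y : Fin m → ℂ) : (W.submatrix id (Fin.castLE hm)) *ᵥ
      ((W.submatrix id (Fin.castLE hm))ᴴ *ᵥ (W *ᵥ y))
      = W *ᵥ (fun i => if (i : ℕ) < S then y i else 0) := by
    have e1 : (W.submatrix id (Fin.castLE hm))ᴴ *ᵥ (W *ᵥ y) = fun k => y (Fin.castLE hm k) := by
      have e2 : Wᴴ *ᵥ (W *ᵥ y) = y := by rw [mulVec_mulVec, hWW, one_mulVec]
      funext k
      exact congrFun e2 (Fin.castLE hm k)
    rw [e1]
    funext i
    simp only [mulVec, dotProduct, submatrix_apply, id_eq]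
    rw [← Finset.sum_image (s := Finset.univ) (g := Fin.castLE hm) (f := fun j => W i j * y j)
      fun _ _ _ _ h => Fin.castLE_injective hm h]
    simp only [mul_ite, mul_zero]
    rw [← Finset.sum_filter]
    refine Finset.sum_congr ?_ fun _ _ => rfl
    ext j
    simp only [Finset.mem_image, Finset.mem_univ, true_and, Finset.mem_filter]
    constructor
    · rintro ⟨k, rfl⟩
      simp
    · exact fun hj => ⟨⟨j, hj⟩, rfl⟩
  rw [hAv, hproj, ← mulVec_sub, en_isometry_mulVec hWW, ← hun]
  refine le_of_sq_le_sq ?_ (mul_nonneg (specNorm_nonneg _) (en_nonneg _))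
  rw [mul_pow, en_sq, en_sq, Finset.mul_sum]
  -- The sum over j has at most one nonzero term; after exchanging sums each column is met at most
  -- once, whichever of m and n is larger.
  have hterm (i : Fin m) : ‖(D *ᵥ u - fun i : Fin m => if (i : ℕ) < S then (D *ᵥ u) i else 0) i‖ ^ 2
      ≤ ∑ j : Fin n, if (i : ℕ) = (j : ℕ) then specNorm N ^ 2 * ‖u j‖ ^ 2 else 0 := by
    have hnn : 0 ≤ ∑ j : Fin n, if (i : ℕ) = (j : ℕ) then specNorm N ^ 2 * ‖u j‖ ^ 2 else 0 :=
      Finset.sum_nonneg fun j _ => by split_ifs <;> positivity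
    simp only [Pi.sub_apply]
    by_cases hi : (i : ℕ) < S
    · rw [if_pos hi]; simpa using hnn
    rw [if_neg hi, sub_zero, hD, rectDiagonal_mulVec]
    split_ifs with hin
    · refine le_trans ?_ (Finset.single_le_sum (fun j _ => ?_) (Finset.mem_univ (⟨i, hin⟩ : Fin n)))
      · rw [if_pos rfl, norm_mul, mul_pow, Complex.norm_real, Real.norm_of_nonneg (hW.nonneg _)]
        refine mul_le_mul_of_nonneg_right ?_ (by positivity)
        exact pow_le_pow_left₀ (hW.nonneg _) (hs (by omega) i.2 hin) 2
      · split_ifs <;> positivity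
    · simpa using hnn
  refine (Finset.sum_le_sum fun i _ => hterm i).trans ?_
  rw [Finset.sum_comm]
  refine Finset.sum_le_sum fun j _ => ?_
  by_cases hj : (j : ℕ) < m
  · rw [Finset.sum_eq_single (⟨j, hj⟩ : Fin m)]
    · simp
    · intro i _ hi
      rw [if_neg]
      exact fun h => hi (Fin.ext h)
    · simp
  · rw [Finset.sum_eq_zero]
    · positivity
    · intro i _
      rw [if_neg]
      have := i.2
      omega

/-! ### Eigenvalues of a perturbed diagonal matrix. -/

/-- Pointwise identities in x are closed conditions on the pair (A, z), as the compactness argument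
for paths requires. -/
theorem roots_charpoly_eq_of_eval_eq {S : ℕ} {A : Matrix (Fin S) (Fin S) ℂ} {z : Fin S → ℂ}
    (h : ∀ x : ℂ, (Matrix.scalar (Fin S) x - A).det = ∏ i, (x - z i)) :
    A.charpoly.roots = Finset.univ.val.map z := by
  have e : A.charpoly = ((Finset.univ.val.map z).map fun a => Polynomial.X - Polynomial.C a).prod := by
    refine Polynomial.funext fun x => ?_
    rw [Matrix.eval_charpoly, h, Multiset.map_map, ← Finset.prod_eq_multiset_prod,
      Polynomial.eval_prod]
    simp
  rw [e, Polynomial.roots_multiset_prod_X_sub_C]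

theorem det_scalar_sub_eq_prod {S : ℕ} {A : Matrix (Fin S) (Fin S) ℂ} {z : Fin S → ℂ}
    (h : A.charpoly.roots = Finset.univ.val.map z) (x : ℂ) :
    (Matrix.scalar (Fin S) x - A).det = ∏ i, (x - z i) := by
  have e := Polynomial.prod_multiset_X_sub_C_of_monic_of_roots_card_eq A.charpoly_monic
    (by rw [h, A.charpoly_natDegree_eq_dim]; simp)
  rw [← Matrix.eval_charpoly, ← e, h, Multiset.map_map, ← Finset.prod_eq_multiset_prod,
    Polynomial.eval_prod]
  simp

theorem exists_roots_charpoly_eq {S : ℕ} (A : Matrix (Fin S) (Fin S) ℂ) :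
    ∃ z : Fin S → ℂ, A.charpoly.roots = Finset.univ.val.map z := by
  have hc : A.charpoly.roots.toList.length = S := by
    rw [Multiset.length_toList,
      Polynomial.splits_iff_card_roots.1 (IsAlgClosed.splits A.charpoly),
      A.charpoly_natDegree_eq_dim, Fintype.card_fin]
  refine ⟨fun i => A.charpoly.roots.toList.get (Fin.cast hc.symm i), ?_⟩
  conv_lhs => rw [← Multiset.coe_toList A.charpoly.roots]
  rw [Fin.univ_val_map]
  congr 1
  refine List.ext_getElem (by simp [hc]) fun n h1 h2 => by simp

/-- The number of eigenvalues in a compact set is constant along a path of matrices whose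
eigenvalues avoid the complement of two disjoint compact sets. -/
theorem card_eigenvalues_eq_of_path {S : ℕ} {A : ℝ → Matrix (Fin S) (Fin S) ℂ} (hA : Continuous A)
    {K K' : Set ℂ} (hK : IsCompact K) (hK' : IsCompact K') (hd : Disjoint K K')
    (hroot : ∀ t ∈ Set.Icc (0 : ℝ) 1, ∀ x, (A t).charpoly.IsRoot x → x ∈ K ∪ K')
    {z w : Fin S → ℂ} (hz : (A 0).charpoly.roots = Finset.univ.val.map z)
    (hw : (A 1).charpoly.roots = Finset.univ.val.map w) :
    Nat.card {i // z i ∈ K} = Nat.card {i // w i ∈ K} := by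
  classical
  -- Pairs of a time and a full list of eigenvalues, with exactly the indices in I assigned to K.
  -- Compactness replaces a continuous choice of eigenvalues.
  let X (I : Finset (Fin S)) : Set (ℝ × (Fin S → ℂ)) :=
    {q | q.1 ∈ Set.Icc (0 : ℝ) 1 ∧ (∀ i, q.2 i ∈ if i ∈ I then K else K') ∧
      ∀ x : ℂ, (Matrix.scalar (Fin S) x - A q.1).det = ∏ i, (x - q.2 i)}
  have hXc (I : Finset (Fin S)) : IsCompact (X I) := by
    have h1 : IsCompact (Set.Icc (0 : ℝ) 1 ×ˢ
        Set.pi Set.univ fun i : Fin S => if i ∈ I then K else K') := by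
      refine isCompact_Icc.prod (isCompact_univ_pi fun i => ?_)
      split_ifs <;> assumption
    have h2 : IsClosed {q : ℝ × (Fin S → ℂ) |
        ∀ x : ℂ, (Matrix.scalar (Fin S) x - A q.1).det = ∏ i, (x - q.2 i)} := by
      simp only [Set.ofPred_forall]
      refine isClosed_iInter fun x => isClosed_eq ?_ ?_
      · exact (continuous_const.sub (hA.comp continuous_fst)).matrix_det
      · fun_prop
    refine (h1.inter_right h2).of_isClosed_subset ?_ ?_
    · have : X I = (Set.Icc (0 : ℝ) 1 ×ˢ
          Set.pi Set.univ fun i : Fin S => if i ∈ I then K else K') ∩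
          {q : ℝ × (Fin S → ℂ) |
            ∀ x : ℂ, (Matrix.scalar (Fin S) x - A q.1).det = ∏ i, (x - q.2 i)} := by
        ext q
        simp [X, and_assoc]
      rw [this]
      exact (h1.inter_right h2).isClosed
    · rintro q ⟨h1, h2, h3⟩
      exact ⟨⟨h1, fun i _ => h2 i⟩, h3⟩
  have hcard {I : Finset (Fin S)} {t : ℝ} {u : Fin S → ℂ} (hq : (t, u) ∈ X I) :
      (A t).charpoly.roots.countP (· ∈ K) = I.card := by
    rw [roots_charpoly_eq_of_eval_eq hq.2.2, Multiset.countP_map]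
    change (Finset.univ.filter fun i => u i ∈ K).card = I.card
    congr 1
    ext i
    have := hq.2.1 i
    by_cases hi : i ∈ I
    · simpa [hi] using this
    · simp only [hi, if_false] at this
      simpa [hi] using fun h => Set.disjoint_left.1 hd h this
  have hmem {t : ℝ} (ht : t ∈ Set.Icc (0 : ℝ) 1) {u : Fin S → ℂ}
      (hu : (A t).charpoly.roots = Finset.univ.val.map u) :
      (t, u) ∈ X (Finset.univ.filter fun i => u i ∈ K) := by
    refine ⟨ht, fun i => ?_, det_scalar_sub_eq_prod hu⟩
    have : u i ∈ K ∪ K' := by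
      refine hroot t ht _ (Polynomial.isRoot_of_mem_roots ?_)
      rw [hu]
      exact Multiset.mem_map_of_mem _ (Finset.mem_univ i)
    by_cases hi : u i ∈ K
    · simp [hi]
    · simpa [hi] using this
  -- The times at which the number of eigenvalues in K satisfies P: a finite union of projections of
  -- compact sets, hence closed. The times with count k and those with count ≠ k then contradict
  -- connectedness of [0, 1].
  let T (P : ℕ → Prop) : Set ℝ := ⋃ I : {I : Finset (Fin S) // P I.card}, Prod.fst '' X I.1
  have hT (P : ℕ → Prop) : IsClosed (T P) :=
    isClosed_iUnion_of_finite fun I => ((hXc I.1).image continuous_fst).isClosed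
  have hTm (P : ℕ → Prop) {t : ℝ} (ht : t ∈ T P) :
      P ((A t).charpoly.roots.countP (· ∈ K)) := by
    obtain ⟨⟨I, hI⟩, ⟨t', u⟩, hq, rfl⟩ := Set.mem_iUnion.1 ht
    rw [hcard hq]
    exact hI
  have hTm' (P : ℕ → Prop) {t : ℝ} (ht : t ∈ Set.Icc (0 : ℝ) 1) {u : Fin S → ℂ}
      (hu : (A t).charpoly.roots = Finset.univ.val.map u)
      (hP : P (Finset.univ.filter fun i => u i ∈ K).card) : t ∈ T P :=
    Set.mem_iUnion.2 ⟨⟨_, hP⟩, _, hmem ht hu, rfl⟩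
  simp only [Nat.card_eq_fintype_card, Fintype.card_subtype]
  by_contra hne
  set k := (Finset.univ.filter fun i => z i ∈ K).card with hk
  obtain ⟨t, -, ht1, ht2⟩ := isPreconnected_closed_iff.1 (isPreconnected_Icc (a := (0 : ℝ)) (b := 1))
    (T (· = k)) (T (· ≠ k)) (hT (· = k)) (hT (· ≠ k)) (fun t ht => by
      obtain ⟨u, hu⟩ := exists_roots_charpoly_eq (A t)
      by_cases h : (Finset.univ.filter fun i => u i ∈ K).card = k
      · exact Or.inl (hTm' (· = k) ht hu h)
      · exact Or.inr (hTm' (· ≠ k) ht hu h))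
    ⟨0, by simp, hTm' (· = k) (by simp) hz hk.symm⟩ ⟨1, by simp, hTm' (· ≠ k) (by simp) hw (Ne.symm hne)⟩
  exact hTm (· ≠ k) ht2 (hTm (· = k) ht1)

/-- The Bauer–Fike theorem for a perturbation of a diagonal matrix. -/
theorem exists_norm_sub_le_of_isRoot {S : ℕ} (lam : Fin S → ℂ) (E : Matrix (Fin S) (Fin S) ℂ)
    {r : ℝ} (hE : ∀ v, en (E *ᵥ v) ≤ r * en v) {x : ℂ}
    (hx : (diagonal lam + E).charpoly.IsRoot x) : ∃ i, ‖x - lam i‖ ≤ r := by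
  rw [Polynomial.IsRoot, Matrix.eval_charpoly] at hx
  obtain ⟨v, hv0, hv⟩ := Matrix.exists_mulVec_eq_zero_iff.2 hx
  by_contra! hcon
  have hr : 0 ≤ r := nonneg_of_mul_nonneg_left ((en_nonneg _).trans (hE v)) (en_pos hv0)
  have hEv (i : Fin S) : (E *ᵥ v) i = (x - lam i) * v i := by
    have := congrFun hv i
    rw [sub_mulVec, add_mulVec] at this
    simp only [scalar_apply, Pi.sub_apply, Pi.add_apply, mulVec_diagonal, Pi.zero_apply] at this
    linear_combination -this
  have h1 : en (E *ᵥ v) ^ 2 ≤ (r * en v) ^ 2 := pow_le_pow_left₀ (en_nonneg _) (hE v) 2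
  rw [mul_pow, en_sq, en_sq, Finset.mul_sum] at h1
  obtain ⟨i, hi⟩ := Function.ne_iff.1 hv0
  -- If x were farther than r from every λ_i, then E v = (x - λ) v would be longer than r‖v‖.
  refine absurd h1 (not_le.2 (Finset.sum_lt_sum (fun j _ => ?_) ⟨i, Finset.mem_univ i, ?_⟩))
  · rw [hEv, norm_mul, mul_pow]
    exact mul_le_mul_of_nonneg_right (pow_le_pow_left₀ hr (hcon j).le 2) (by positivity)
  · rw [hEv, norm_mul, mul_pow]
    have : 0 < ‖v i‖ := norm_pos_iff.2 hi
    exact mul_lt_mul_of_pos_right (pow_lt_pow_left₀ (hcon i) hr two_ne_zero) (by positivity)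

/-- Two indices are adjacent if the closed discs of radius `r` about their points can meet. -/
def discGraph {S : ℕ} (lam : Fin S → ℂ) (r : ℝ) : SimpleGraph (Fin S) where
  Adj i j := i ≠ j ∧ ‖lam i - lam j‖ ≤ 2 * r
  symm := ⟨fun i j h => ⟨h.1.symm, by rw [norm_sub_rev]; exact h.2⟩⟩
  loopless := ⟨fun i h => h.1 rfl⟩

/-- Makes the component attached to a point of the union of discs independent of the disc chosen. -/
theorem discGraph_reachable_of_mem {S : ℕ} {lam : Fin S → ℂ} {r : ℝ} {i j : Fin S} {x : ℂ}
    (hi : ‖x - lam i‖ ≤ r) (hj : ‖x - lam j‖ ≤ r) : (discGraph lam r).Reachable i j := by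
  by_cases hij : i = j
  · rw [hij]
  · refine SimpleGraph.Adj.reachable ⟨hij, ?_⟩
    calc ‖lam i - lam j‖ = ‖(x - lam j) - (x - lam i)‖ := by congr 1; ring
      _ ≤ ‖x - lam j‖ + ‖x - lam i‖ := norm_sub_le _ _
      _ ≤ 2 * r := by linarith

theorem norm_sub_le_of_walk {S : ℕ} {lam : Fin S → ℂ} {r : ℝ} {i j : Fin S}
    (p : (discGraph lam r).Walk i j) : ‖lam i - lam j‖ ≤ 2 * r * p.length := by
  induction p with
  | nil => simp
  | @cons u v w h p ih =>
    calc ‖lam u - lam w‖ = ‖(lam u - lam v) + (lam v - lam w)‖ := by congr 1; ring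
      _ ≤ ‖lam u - lam v‖ + ‖lam v - lam w‖ := norm_add_le _ _
      _ ≤ 2 * r + 2 * r * p.length := add_le_add h.2 ih
      _ = _ := by rw [SimpleGraph.Walk.length_cons]; push_cast; ring

/-- A path without repeated vertices has at most S - 1 edges, each of length at most 2r. -/
theorem norm_sub_le_of_reachable {S : ℕ} {lam : Fin S → ℂ} {r : ℝ} (hr : 0 ≤ r) {i j : Fin S}
    (h : (discGraph lam r).Reachable i j) : ‖lam i - lam j‖ ≤ 2 * r * (S - 1) := by
  obtain ⟨p, hp⟩ := h.exists_isPath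
  refine (norm_sub_le_of_walk p).trans (mul_le_mul_of_nonneg_left ?_ (by linarith))
  have h1 := hp.length_lt
  rw [Fintype.card_fin] at h1
  have : ((p.length + 1 : ℕ) : ℝ) ≤ S := by exact_mod_cast h1
  push_cast at this
  linarith

/-- The eigenvalues of a perturbed diagonal matrix, matched with the diagonal entries through the
connected components of the union of discs. -/
theorem exists_perm_eigenvalues {S : ℕ} (lam : Fin S → ℂ) (E : Matrix (Fin S) (Fin S) ℂ)
    {r : ℝ} (hr : 0 ≤ r) (hE : ∀ v, en (E *ᵥ v) ≤ r * en v) {ev : Fin S → ℂ}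
    (hev : (diagonal lam + E).charpoly.roots = Finset.univ.val.map ev) :
    ∃ ψ : Equiv.Perm (Fin S), ∀ j, ∃ i, (discGraph lam r).Reachable i j ∧
      ‖ev (ψ j) - lam i‖ ≤ r := by
  classical
  set G := discGraph lam r with hG
  let A (t : ℝ) : Matrix (Fin S) (Fin S) ℂ := diagonal lam + (t : ℂ) • E
  have hA : Continuous A := by fun_prop
  have hroot (t : ℝ) (ht : t ∈ Set.Icc (0 : ℝ) 1) (x : ℂ) (hx : (A t).charpoly.IsRoot x) :
      ∃ i, ‖x - lam i‖ ≤ r := by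
    refine exists_norm_sub_le_of_isRoot lam _ (fun v => ?_) hx
    rw [smul_mulVec, en_smul, Complex.norm_real, Real.norm_of_nonneg ht.1]
    exact (mul_le_of_le_one_left (en_nonneg _) ht.2).trans (hE v)
  have h0 : (A 0).charpoly.roots = Finset.univ.val.map lam := by
    have : A 0 = diagonal lam := by simp [A]
    rw [this]
    refine roots_charpoly_eq_of_eval_eq fun x => ?_
    rw [scalar_apply, diagonal_sub, det_diagonal]
  have h1 : (A 1).charpoly.roots = Finset.univ.val.map ev := by
    have : A 1 = diagonal lam + E := by simp [A]
    rw [this, hev]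
  have hevmem (j : Fin S) : ∃ i, ‖ev j - lam i‖ ≤ r := by
    refine hroot 1 (by simp) _ (Polynomial.isRoot_of_mem_roots ?_)
    rw [h1]
    exact Multiset.mem_map_of_mem _ (Finset.mem_univ j)
  choose near hnear using hevmem
  -- Discs of the components satisfying P. For `(· = c)` and `(· ≠ c)` these are disjoint compact
  -- sets that together contain all eigenvalues along the path.
  let K (P : G.ConnectedComponent → Prop) : Set ℂ :=
    ⋃ i : {i // P (G.connectedComponentMk i)}, Metric.closedBall (lam i.1) r
  have hK (P : G.ConnectedComponent → Prop) : IsCompact (K P) :=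
    isCompact_iUnion fun i => isCompact_closedBall _ _
  have hmemK (P : G.ConnectedComponent → Prop) {x : ℂ} {i : Fin S} (hx : ‖x - lam i‖ ≤ r) :
      x ∈ K P ↔ P (G.connectedComponentMk i) := by
    constructor
    · intro h
      obtain ⟨⟨k, hk⟩, hxk⟩ := Set.mem_iUnion.1 h
      rw [mem_closedBall_iff_norm] at hxk
      rwa [SimpleGraph.ConnectedComponent.eq.2 (discGraph_reachable_of_mem hx hxk)]
    · exact fun h => Set.mem_iUnion.2 ⟨⟨i, h⟩, mem_closedBall_iff_norm.2 hx⟩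
  have hcard (c : G.ConnectedComponent) :
      Nat.card {j // G.connectedComponentMk j = c} =
        Nat.card {j // G.connectedComponentMk (near j) = c} := by
    have := card_eigenvalues_eq_of_path hA (hK (· = c)) (hK (· ≠ c))
      (Set.disjoint_left.2 fun x hx hx' => by
        obtain ⟨⟨k, hk⟩, hxk⟩ := Set.mem_iUnion.1 hx
        rw [mem_closedBall_iff_norm] at hxk
        exact (hmemK (· ≠ c) hxk).1 hx' hk)
      (fun t ht x hx => by
        obtain ⟨i, hi⟩ := hroot t ht x hx
        by_cases h : G.connectedComponentMk i = c
        · exact Or.inl ((hmemK (· = c) hi).2 h)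
        · exact Or.inr ((hmemK (· ≠ c) hi).2 h)) h0 h1
    have hlam (j : Fin S) : lam j ∈ K (· = c) ↔ G.connectedComponentMk j = c :=
      hmemK (· = c) (by simpa using hr)
    have hev' (j : Fin S) : ev j ∈ K (· = c) ↔ G.connectedComponentMk (near j) = c :=
      hmemK (· = c) (hnear j)
    simpa only [hlam, hev'] using this
  -- Equal counts on each component give bijections of fibres, which glue to the permutation.
  let e (c : G.ConnectedComponent) : {j // G.connectedComponentMk j = c} ≃
      {j // G.connectedComponentMk (near j) = c} := (Finite.card_eq.1 (hcard c)).some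
  refine ⟨Equiv.ofFiberEquiv e, fun j => ⟨near (Equiv.ofFiberEquiv e j), ?_, hnear _⟩⟩
  exact SimpleGraph.ConnectedComponent.eq.1 (Equiv.ofFiberEquiv_map e j)

/-! ### Angles and distances on the circle. -/

/-- In the right half plane, Jordan's inequality and |sin arg z| ≤ |z - 1| suffice; in the left one,
|z - 1| ≥ 1 and |arg z| ≤ π. -/
theorem abs_arg_le_pi_mul_norm_sub_one (z : ℂ) : |z.arg| ≤ Real.pi * ‖z - 1‖ := by
  have hre : |z.re - 1| ≤ ‖z - 1‖ := by simpa using Complex.abs_re_le_norm (z - 1)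
  by_cases h : 0 ≤ z.re
  · have h1 := Real.mul_abs_le_abs_sin (Complex.abs_arg_le_pi_div_two_iff.2 h)
    have h2 : |Real.sin z.arg| ≤ ‖z - 1‖ := by
      refine abs_le_of_sq_le_sq ?_ (norm_nonneg _)
      rw [Complex.sq_norm, Complex.normSq_apply]
      have e1 := Complex.norm_mul_cos_arg z
      have e2 := Complex.norm_mul_sin_arg z
      simp only [Complex.sub_re, Complex.sub_im, Complex.one_re, Complex.one_im, sub_zero]
      rw [← e1, ← e2]
      nlinarith [Real.sin_sq_add_cos_sq z.arg, sq_nonneg (‖z‖ - Real.cos z.arg)]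
    have hpi := Real.pi_pos
    have h3 := h1.trans h2
    rw [div_mul_eq_mul_div, div_le_iff₀ hpi] at h3
    nlinarith [abs_nonneg z.arg]
  · push Not at h
    have h1 : 1 ≤ ‖z - 1‖ := by
      refine le_trans ?_ hre
      rw [abs_of_neg (by linarith)]
      linarith
    calc |z.arg| ≤ Real.pi := Complex.abs_arg_le_pi z
      _ = Real.pi * 1 := (mul_one _).symm
      _ ≤ _ := mul_le_mul_of_nonneg_left h1 Real.pi_pos.le

theorem dist_unitAddCircle_le_half (x y : UnitAddCircle) : dist x y ≤ 1 / 2 := by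
  rw [dist_eq_norm]
  simpa using AddCircle.norm_le_half_period (1 : ℝ) (x := x - y) one_ne_zero

theorem norm_fourier_apply (n : ℤ) (x : UnitAddCircle) : ‖fourier n x‖ = 1 := by
  rw [fourier_apply]
  exact Circle.norm_coe _

/-- The angle of `z`, divided by `-2π`, is as close to `w` as `z` is to the point `e^{-2πiw}`. -/
theorem dist_arg_le (z : ℂ) (w : UnitAddCircle) :
    dist ((-z.arg / (2 * Real.pi) : ℝ) : UnitAddCircle) w ≤ 1 / 2 * ‖z - fourier (-1) w‖ := by
  by_cases hz : z = 0
  · rw [hz, zero_sub, norm_neg, norm_fourier_apply, mul_one]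
    exact dist_unitAddCircle_le_half _ _
  obtain ⟨t, rfl⟩ := QuotientAddGroup.mk_surjective w
  have hpi := Real.pi_pos
  have hlam : fourier (-1) (t : UnitAddCircle) =
      Complex.exp (((-(2 * Real.pi * t) : ℝ) : ℂ) * Complex.I) := by
    rw [fourier_coe_apply]
    congr 1
    push_cast
    ring
  -- Rotate so that the target becomes 1; the integer k below absorbs the 2π ambiguity of the
  -- argument.
  set u : ℂ := z * Complex.exp (((2 * Real.pi * t : ℝ) : ℂ) * Complex.I) with hu
  have hexp : Complex.exp (((-(2 * Real.pi * t) : ℝ) : ℂ) * Complex.I) *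
      Complex.exp (((2 * Real.pi * t : ℝ) : ℂ) * Complex.I) = 1 := by
    rw [← Complex.exp_add, ← Complex.exp_zero]
    congr 1
    push_cast
    ring
  have hnorm : ‖u - 1‖ = ‖z - fourier (-1) (t : UnitAddCircle)‖ := by
    rw [hlam, ← hexp, hu, ← sub_mul, norm_mul, Complex.norm_exp_ofReal_mul_I, mul_one]
  have hang : (u.arg : Real.Angle) = ((z.arg + 2 * Real.pi * t : ℝ) : Real.Angle) := by
    rw [hu, Complex.arg_mul_coe_angle hz (Complex.exp_ne_zero _), Real.Angle.coe_add,
      Complex.exp_mul_I]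
    congr 1
    have h := Complex.arg_cos_add_sin_mul_I_coe_angle ((2 * Real.pi * t : ℝ) : Real.Angle)
    rwa [Real.Angle.cos_coe, Real.Angle.sin_coe, Complex.ofReal_cos, Complex.ofReal_sin] at h
  obtain ⟨k, hk⟩ := Real.Angle.angle_eq_iff_two_pi_dvd_sub.1 hang
  have hle := abs_arg_le_pi_mul_norm_sub_one u
  change dist _ (t : UnitAddCircle) ≤ 1 / 2 * ‖z - fourier (-1) (t : UnitAddCircle)‖
  rw [dist_eq_norm, ← AddCircle.coe_sub, UnitAddCircle.norm_eq, ← hnorm]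
  refine (round_le _ k).trans ?_
  have e : -z.arg / (2 * Real.pi) - t - k = -u.arg / (2 * Real.pi) := by
    field_simp
    linarith
  rw [e, abs_div, abs_neg, abs_of_pos (by positivity : 0 < 2 * Real.pi), div_le_iff₀ (by positivity)]
  linarith

theorem fourier_neg_one_injective :
    Function.Injective fun w : UnitAddCircle => fourier (-1) w := by
  intro x y h
  simp only [fourier_apply] at h
  have := AddCircle.injective_toCircle one_ne_zero (Subtype.ext h)
  simpa using this

theorem fourier_neg_natCast (k : ℕ) (w : UnitAddCircle) :
    fourier (-(k : ℤ)) w = fourier (-1) w ^ k := by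
  induction k with
  | zero => simp
  | succ k ih =>
    rw [pow_succ, ← ih, ← fourier_add]
    congr 2
    push_cast
    ring

theorem dist_le_half_norm_fourier_sub (v w : UnitAddCircle) :
    dist v w ≤ 1 / 2 * ‖fourier (-1) v - fourier (-1) w‖ := by
  have h := dist_arg_le (fourier (-1) v) w
  have h0 := dist_arg_le (fourier (-1) v) v
  rw [sub_self, norm_zero, mul_zero] at h0
  rwa [dist_le_zero.1 h0] at h

/-! ### Vandermonde and Hankel matrices. -/

theorem firstRows_mulVec {L S : ℕ} (A : Matrix (Fin (L + 1)) (Fin S) ℂ) (v : Fin S → ℂ) :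
    firstRows A *ᵥ v = (A *ᵥ v) ∘ Fin.castSucc := rfl

theorem lastRows_mulVec {L S : ℕ} (A : Matrix (Fin (L + 1)) (Fin S) ℂ) (v : Fin S → ℂ) :
    lastRows A *ᵥ v = (A *ᵥ v) ∘ Fin.succ := rfl

theorem vandermonde_apply_eq_pow {S : ℕ} (N : ℕ) (ω : Fin S → UnitAddCircle) (k : Fin (N + 1))
    (j : Fin S) : vandermonde N ω k j = fourier (-1) (ω j) ^ (k : ℕ) :=
  fourier_neg_natCast _ _

/-- The rotational invariance of the Vandermonde matrix. -/
theorem lastRows_vandermonde {S : ℕ} (N : ℕ) (ω : Fin S → UnitAddCircle) :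
    lastRows (vandermonde N ω) =
      firstRows (vandermonde N ω) * diagonal fun j => fourier (-1) (ω j) := by
  ext k j
  simp [lastRows, firstRows, vandermonde_apply_eq_pow, mul_diagonal, pow_succ]

/-- Distinct nodes make any S consecutive powers from 0 enough. The cutoff K serves both the full
matrix and its first rows. -/
theorem eq_zero_of_vandermonde_mulVec {S : ℕ} {N : ℕ} {ω : Fin S → UnitAddCircle}
    (hω : Function.Injective ω) {d : Fin S → ℂ} {K : ℕ} (hK : K ≤ N + 1) (hS : S ≤ K)
    (h : ∀ k : Fin (N + 1), (k : ℕ) < K → (vandermonde N ω *ᵥ d) k = 0) : d = 0 := by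
  refine eq_zero_of_forall_pow_sum_mul_pow_eq_zero
    (f := fun j => fourier (-1) (ω j)) (fourier_neg_one_injective.comp hω) fun i => ?_
  rw [← h ⟨i, by omega⟩ (by simp; omega)]
  simp only [mulVec, dotProduct, vandermonde_apply_eq_pow]
  exact Finset.sum_congr rfl fun j _ => mul_comm _ _

theorem sv_vandermonde_pos {S : ℕ} (hS : 1 ≤ S) {N : ℕ} (hN : S ≤ N + 1)
    {ω : Fin S → UnitAddCircle} (hω : Function.Injective ω) : 0 < sv S (vandermonde N ω) := by
  refine sv_pos hS _ fun d hd => eq_zero_of_vandermonde_mulVec hω le_rfl hN fun k _ => ?_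
  rw [hd]
  rfl

/-- Test on a basis vector: each column has N + 1 unimodular entries. -/
theorem sv_vandermonde_le {S : ℕ} (hS : 1 ≤ S) (N : ℕ) (ω : Fin S → UnitAddCircle) :
    sv S (vandermonde N ω) ≤ Real.sqrt ((N : ℝ) + 1) := by
  set e : Fin S → ℂ := Pi.single ⟨0, hS⟩ 1 with he
  have h := sv_mul_en_le hS (vandermonde N ω) e
  have h1 : en e = 1 := by
    rw [← sq_eq_sq₀ (en_nonneg _) zero_le_one, en_sq, Finset.sum_eq_single ⟨0, hS⟩]
    · simp [he]
    · intro j _ hj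
      simp [he, hj]
    · simp
  have h2 : en (vandermonde N ω *ᵥ e) = Real.sqrt ((N : ℝ) + 1) := by
    rw [← sq_eq_sq₀ (en_nonneg _) (Real.sqrt_nonneg _), en_sq, Real.sq_sqrt (by positivity), he]
    simp only [mulVec_single_one, col_apply, vandermonde_apply_eq_pow, norm_pow, norm_fourier_apply]
    simp
  rwa [h1, mul_one, h2] at h

theorem hankel_samples {L M S : ℕ} (hLM : L ≤ M) (x : Fin S → ℂ) (ω : Fin S → UnitAddCircle) :
    hankel L (samples M x ω) =
      vandermonde L ω * (diagonal x * (vandermonde (M - L) ω)ᵀ) := by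
  ext i j
  have hij : (i : ℕ) + j < M + 1 := by
    have := i.2
    have := j.2
    omega
  simp only [hankel, samples, of_apply, mul_apply (M := vandermonde L ω), diagonal_mul,
    transpose_apply, vandermonde_apply_eq_pow, fourier_neg_natCast]
  refine Finset.sum_congr rfl fun k _ => ?_
  rw [Fin.val_ofNat, Nat.mod_eq_of_lt hij, pow_add]
  ring

theorem hankel_add {L M : ℕ} (y z : Fin (M + 1) → ℂ) :
    hankel L (y + z) = hankel L y + hankel L z := rfl

theorem minAmp_le {S : ℕ} (x : Fin S → ℂ) (j : Fin S) : minAmp x ≤ ‖x j‖ :=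
  ciInf_le (Set.finite_range _).bddBelow j

theorem minAmp_pos {S : ℕ} (hS : 1 ≤ S) {x : Fin S → ℂ} (hx : ∀ j, x j ≠ 0) : 0 < minAmp x := by
  have : Nonempty (Fin S) := ⟨⟨0, hS⟩⟩
  obtain ⟨j, hj⟩ := exists_eq_ciInf_of_finite (f := fun j => ‖x j‖)
  rw [minAmp, ← hj]
  exact norm_pos_iff.2 (hx j)

/-- The right factor of the noiseless Hankel matrix has a bounded right inverse. -/
theorem exists_diagonal_mul_transpose_mulVec_eq {S N : ℕ} (hS : 1 ≤ S) (hN : S ≤ N + 1)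
    {x : Fin S → ℂ} (hx : ∀ j, x j ≠ 0) {ω : Fin S → UnitAddCircle} (hω : Function.Injective ω)
    (c : Fin S → ℂ) : ∃ w, (diagonal x * (vandermonde N ω)ᵀ) *ᵥ w = c ∧
      minAmp x * sv S (vandermonde N ω) * en w ≤ en c := by
  -- Conjugating entries keeps the lower bound and turns the transpose into an adjoint, to which the
  -- right-inverse lemma applies.
  have hb (v : Fin S → ℂ) :
      sv S (vandermonde N ω) * en v ≤ en ((vandermonde N ω).map star *ᵥ v) := by
    have h := sv_mul_en_le hS (vandermonde N ω) (star v)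
    have e : (vandermonde N ω).map star *ᵥ v = star (vandermonde N ω *ᵥ star v) := by
      funext i
      simp [mulVec, dotProduct]
    rwa [e, en_star, ← en_star v]
  obtain ⟨w, hw, hwn⟩ := exists_conjTranspose_mulVec_eq _ (sv_vandermonde_pos hS hN hω) hb
    (fun j => c j / x j)
  have hT : ((vandermonde N ω).map star)ᴴ = (vandermonde N ω)ᵀ := by
    ext i j
    simp
  rw [hT] at hw
  refine ⟨w, ?_, ?_⟩
  · rw [← mulVec_mulVec, hw]
    funext j
    rw [mulVec_diagonal, mul_div_cancel₀ _ (hx j)]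
  · have hmin := minAmp_pos hS hx
    have hc : minAmp x * en (fun j => c j / x j) ≤ en c := by
      refine le_of_sq_le_sq ?_ (en_nonneg _)
      rw [mul_pow, en_sq, en_sq, Finset.mul_sum]
      refine Finset.sum_le_sum fun j _ => ?_
      have hxj : 0 < ‖x j‖ := norm_pos_iff.2 (hx j)
      rw [norm_div, div_pow, mul_div_assoc', div_le_iff₀ (by positivity), mul_comm]
      exact mul_le_mul_of_nonneg_left (pow_le_pow_left₀ hmin.le (minAmp_le x j) 2) (by positivity)
    rw [mul_assoc]
    exact (mul_le_mul_of_nonneg_left hwn hmin.le).trans hc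

/-! ### The pseudoinverse and the perturbed shift relation. -/

theorem en_mulVec_le_of_isHermitian_of_idempotent {n : ℕ} {P : Matrix (Fin n) (Fin n) ℂ}
    (hP : P.IsHermitian) (hPP : P * P = P) (y : Fin n → ℂ) : en (P *ᵥ y) ≤ en y := by
  have h : en (P *ᵥ y) ^ 2 ≤ en y * en (P *ᵥ y) := by
    have := star_dotProduct_self_eq (P *ᵥ y)
    rw [star_mulVec_dotProduct, hP.eq, mulVec_mulVec, hPP] at this
    have h3 := norm_star_dotProduct_le y (P *ᵥ y)
    rwa [this, Complex.norm_real, Real.norm_of_nonneg (by positivity)] at h3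
  rcases (en_nonneg (P *ᵥ y)).eq_or_lt with h0 | h0
  · rw [← h0]; exact en_nonneg y
  · exact le_of_mul_le_mul_right (by rwa [← sq]) h0

/-- A A† is an orthogonal projection, hence a contraction. -/
theorem mul_en_pinv_mulVec_le {m n : ℕ} {A : Matrix (Fin m) (Fin n) ℂ} {σ : ℝ}
    (h : ∀ v, σ * en v ≤ en (A *ᵥ v)) (y : Fin m → ℂ) : σ * en (pinv A *ᵥ y) ≤ en y := by
  refine (h _).trans ?_
  rw [mulVec_mulVec]
  refine en_mulVec_le_of_isHermitian_of_idempotent (isHermitian_mul_pinv A) ?_ y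
  rw [← Matrix.mul_assoc, mul_pinv_mul_self]

theorem eq_zero_of_mulVec_eq_zero_of_le {m n : ℕ} {A : Matrix (Fin m) (Fin n) ℂ} {σ : ℝ}
    (hσ : 0 < σ) (h : ∀ v, σ * en v ≤ en (A *ᵥ v)) {v : Fin n → ℂ} (hv : A *ᵥ v = 0) : v = 0 := by
  have h1 := h v
  rw [hv, en_eq_zero.2 rfl] at h1
  exact en_eq_zero.1 (le_antisymm (nonpos_of_mul_nonpos_right h1 hσ) (en_nonneg v))

theorem pinv_mul_self_eq_one {m n : ℕ} {A : Matrix (Fin m) (Fin n) ℂ} {σ : ℝ}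
    (hσ : 0 < σ) (h : ∀ v, σ * en v ≤ en (A *ᵥ v)) : pinv A * A = 1 := by
  refine Matrix.ext_of_mulVec_single fun i => ?_
  rw [← sub_eq_zero]
  refine eq_zero_of_mulVec_eq_zero_of_le hσ h ?_
  rw [mulVec_sub, mulVec_mulVec, ← Matrix.mul_assoc, mul_pinv_mul_self, one_mulVec, sub_self]

theorem isUnit_of_mulVec_le {n : ℕ} {A : Matrix (Fin n) (Fin n) ℂ} {σ : ℝ}
    (hσ : 0 < σ) (h : ∀ v, σ * en v ≤ en (A *ᵥ v)) : IsUnit A := by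
  rw [← Matrix.mulVec_injective_iff_isUnit, ← Matrix.coe_mulVecLin, injective_iff_map_eq_zero]
  exact fun v hv => eq_zero_of_mulVec_eq_zero_of_le hσ h (by simpa using hv)

/-- If the columns of `F` are shift invariant with multipliers `lam` and nearly lie in the range of
the isometry `U`, then the matrix `U₀† U₁` is similar to a small perturbation of
`diag(lam)`. -/
theorem exists_charpoly_pinv_mul_eq {L S : ℕ} {F U : Matrix (Fin (L + 1)) (Fin S) ℂ}
    {lam : Fin S → ℂ} (hlam : ∀ j, ‖lam j‖ = 1)
    (hshift : lastRows F = firstRows F * diagonal lam) {σ σ₀ τ : ℝ} (hσ : 0 < σ)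
    (hF : ∀ d, σ * en d ≤ en (F *ᵥ d)) (hσ₀ : 0 < σ₀) (hσ₀1 : σ₀ ≤ 1)
    (hF₀ : ∀ d, σ₀ * en (F *ᵥ d) ≤ en (firstRows F *ᵥ d)) (hU : Uᴴ * U = 1) (hτ0 : 0 ≤ τ)
    (hτ : 2 * τ ≤ σ₀) (hZ : ∀ d, en (F *ᵥ d - U *ᵥ (Uᴴ *ᵥ (F *ᵥ d))) ≤ τ * σ * en d) :
    ∃ E : Matrix (Fin S) (Fin S) ℂ,
      (pinv (firstRows U) * lastRows U).charpoly = (diagonal lam + E).charpoly ∧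
      ∀ v, en (E *ᵥ v) ≤ 8 * τ / σ₀ * en v := by
  obtain ⟨Q, hQ⟩ : ∃ Q, Q = Uᴴ * F := ⟨_, rfl⟩
  have hUQ (d : Fin S → ℂ) : U *ᵥ (Q *ᵥ d) = U *ᵥ (Uᴴ *ᵥ (F *ᵥ d)) := by
    rw [hQ, ← mulVec_mulVec]
  have hZF (d : Fin S → ℂ) : en (F *ᵥ d - U *ᵥ (Q *ᵥ d)) ≤ τ * en (F *ᵥ d) := by
    rw [hUQ]
    refine (hZ d).trans ?_
    rw [mul_assoc]
    exact mul_le_mul_of_nonneg_left (hF d) hτ0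
  -- τ ≤ σ₀/2 ≤ 1/2, so projecting onto range U keeps at least half of the length of F d.
  have hQlow (d : Fin S → ℂ) : σ / 2 * en d ≤ en (Q *ᵥ d) := by
    have h1 := en_add_le (F *ᵥ d - U *ᵥ (Q *ᵥ d)) (U *ᵥ (Q *ᵥ d))
    rw [sub_add_cancel, en_isometry_mulVec hU] at h1
    nlinarith [hZF d, hF d, en_nonneg (F *ᵥ d)]
  have hQU : IsUnit Q := isUnit_of_mulVec_le (by positivity) hQlow
  have hQdet := (Matrix.isUnit_iff_isUnit_det Q).1 hQU
  have hU₀ (c : Fin S → ℂ) : σ₀ / 2 * en c ≤ en (firstRows U *ᵥ c) := by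
    obtain ⟨d, rfl⟩ : ∃ d, Q *ᵥ d = c :=
      ⟨Q⁻¹ *ᵥ c, by rw [mulVec_mulVec, Matrix.mul_nonsing_inv _ hQdet, one_mulVec]⟩
    have h1 : en (Q *ᵥ d) ≤ en (F *ᵥ d) := by
      rw [hQ, ← mulVec_mulVec]
      exact en_conjTranspose_isometry_mulVec_le hU _
    have h2 : firstRows F *ᵥ d = (F *ᵥ d - U *ᵥ (Q *ᵥ d)) ∘ Fin.castSucc
        + firstRows U *ᵥ (Q *ᵥ d) := by
      rw [firstRows_mulVec, firstRows_mulVec]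
      funext i
      simp
    have h3 := en_add_le ((F *ᵥ d - U *ᵥ (Q *ᵥ d)) ∘ Fin.castSucc) (firstRows U *ᵥ (Q *ᵥ d))
    rw [← h2] at h3
    have h4 := en_comp_le (Fin.castSucc_injective L) (F *ᵥ d - U *ᵥ (Q *ᵥ d))
    nlinarith [hZF d, hF₀ d, en_nonneg (F *ᵥ d)]
  -- The defect of the shift relation in the basis U Q. It vanishes exactly for F, so only two
  -- projection residuals, each at most τσ‖v‖, remain.
  obtain ⟨R, hR⟩ : ∃ R, R = lastRows U * Q - firstRows U * Q * diagonal lam := ⟨_, rfl⟩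
  have hRle (v : Fin S → ℂ) : en (R *ᵥ v) ≤ 2 * τ * σ * en v := by
    have hsv : (F *ᵥ v) ∘ Fin.succ = (F *ᵥ (diagonal lam *ᵥ v)) ∘ Fin.castSucc := by
      rw [← lastRows_mulVec, ← firstRows_mulVec, mulVec_mulVec, hshift]
    have e : R *ᵥ v = (F *ᵥ (diagonal lam *ᵥ v) - U *ᵥ (Q *ᵥ (diagonal lam *ᵥ v))) ∘ Fin.castSucc
        - (F *ᵥ v - U *ᵥ (Q *ᵥ v)) ∘ Fin.succ := by
      rw [hR, sub_mulVec, ← mulVec_mulVec, ← mulVec_mulVec, ← mulVec_mulVec, lastRows_mulVec,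
        firstRows_mulVec]
      funext i
      have := congrFun hsv i
      simp only [Function.comp_apply, Pi.sub_apply] at this ⊢
      rw [this]
      ring
    have hD : en (diagonal lam *ᵥ v) = en v := by
      rw [← sq_eq_sq₀ (en_nonneg _) (en_nonneg _), en_sq, en_sq]
      simp [mulVec_diagonal, hlam]
    have h1 := en_comp_le (Fin.castSucc_injective L)
      (F *ᵥ (diagonal lam *ᵥ v) - U *ᵥ (Q *ᵥ (diagonal lam *ᵥ v)))
    have h2 := en_comp_le (Fin.succ_injective L) (F *ᵥ v - U *ᵥ (Q *ᵥ v))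
    have h3 := hZ v
    have h4 := hZ (diagonal lam *ᵥ v)
    rw [← hUQ] at h3 h4
    rw [hD] at h4
    rw [e]
    refine (en_sub_le _ _).trans ?_
    linarith
  have hpinv := pinv_mul_self_eq_one (half_pos hσ₀) hU₀
  -- The constant 8τ/σ₀ is the product of 2/σ for Q⁻¹, 2/σ₀ for the pseudoinverse and 2τσ for R.
  refine ⟨Q⁻¹ * (pinv (firstRows U) * R), ?_, fun v => ?_⟩
  · have e : Q⁻¹ * (pinv (firstRows U) * lastRows U) * Q =
        diagonal lam + Q⁻¹ * (pinv (firstRows U) * R) := by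
      have e1 : pinv (firstRows U) * R = pinv (firstRows U) * lastRows U * Q - Q * diagonal lam := by
        rw [hR, Matrix.mul_sub, ← Matrix.mul_assoc, ← Matrix.mul_assoc, ← Matrix.mul_assoc, hpinv,
          Matrix.one_mul]
      rw [Matrix.mul_assoc, e1, Matrix.mul_sub, ← Matrix.mul_assoc Q⁻¹ Q, Matrix.nonsing_inv_mul _ hQdet,
        Matrix.one_mul, ← Matrix.mul_assoc, add_sub_cancel]
    rw [← e, Matrix.charpoly_mul_comm, ← Matrix.mul_assoc, Matrix.mul_nonsing_inv _ hQdet,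
      Matrix.one_mul]
  · rw [← mulVec_mulVec, ← mulVec_mulVec]
    have h1 : σ₀ / 2 * en (pinv (firstRows U) *ᵥ (R *ᵥ v)) ≤ 2 * τ * σ * en v :=
      (mul_en_pinv_mulVec_le hU₀ _).trans (hRle v)
    generalize pinv (firstRows U) *ᵥ (R *ᵥ v) = y at h1 ⊢
    have h2 := hQlow (Q⁻¹ *ᵥ y)
    rw [mulVec_mulVec, Matrix.mul_nonsing_inv _ hQdet, one_mulVec] at h2
    have h3 : σ₀ * σ * en (Q⁻¹ *ᵥ y) ≤ 8 * τ * σ * en v := by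
      nlinarith [mul_le_mul_of_nonneg_left h2 hσ₀.le]
    rw [div_mul_eq_mul_div, le_div_iff₀ hσ₀]
    exact le_of_mul_le_mul_right (by linarith) hσ

/-! ### Assembling the perturbation bound for ESPRIT. -/

theorem matchingDist_le {S : ℕ} (hS : 1 ≤ S) {ω ωhat : Fin S → UnitAddCircle} {C : ℝ}
    (ψ : Equiv.Perm (Fin S)) (h : ∀ j, dist (ωhat (ψ j)) (ω j) ≤ C) : matchingDist ω ωhat ≤ C := by
  have : Nonempty (Fin S) := ⟨⟨0, hS⟩⟩
  exact (ciInf_le (Set.finite_range _).bddBelow ψ).trans (ciSup_le h)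

theorem sv_firstRows_le_one {L S : ℕ} (hS : 1 ≤ S) {U : Matrix (Fin (L + 1)) (Fin S) ℂ}
    (hU : Uᴴ * U = 1) : sv S (firstRows U) ≤ 1 := by
  set e : Fin S → ℂ := Pi.single ⟨0, hS⟩ 1 with he
  have he0 : e ≠ 0 := by simp [he]
  have h := (sv_mul_en_le hS (firstRows U) e).trans
    (en_comp_le (Fin.castSucc_injective L) (U *ᵥ e))
  rw [en_isometry_mulVec hU] at h
  exact le_of_mul_le_mul_right (by rwa [one_mul]) (en_pos he0)

/-- The leading left singular vectors of a product span the range of its left factor, if the right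
factor is surjective. -/
theorem IsLeadingLeftSingular.mulVec_conjTranspose_mulVec {m n S : ℕ}
    {F : Matrix (Fin m) (Fin S) ℂ} {B : Matrix (Fin S) (Fin n) ℂ} {U : Matrix (Fin m) (Fin S) ℂ}
    (hU : IsLeadingLeftSingular (F * B) U) (hB : ∀ c, ∃ w, B *ᵥ w = c) (d : Fin S → ℂ) :
    U *ᵥ (Uᴴ *ᵥ (F *ᵥ d)) = F *ᵥ d := by
  obtain ⟨w, rfl⟩ := hB d
  have h := hU.en_residual_le (N := 0) (add_zero _).symm w
  have h0 : specNorm (0 : Matrix (Fin m) (Fin n) ℂ) = 0 := by simp [specNorm]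
  rw [h0, zero_mul] at h
  have := en_eq_zero.1 (le_antisymm h (en_nonneg _))
  rw [← mulVec_mulVec, sub_eq_zero] at this
  exact this.symm

/-- F d = U c with c = Uᴴ F d of the same norm, and the first rows of F d are U₀ c. -/
theorem sv_firstRows_mul_le {L S : ℕ} (hS : 1 ≤ S) {F U : Matrix (Fin (L + 1)) (Fin S) ℂ}
    (hUU : Uᴴ * U = 1) (hUF : ∀ d, U *ᵥ (Uᴴ *ᵥ (F *ᵥ d)) = F *ᵥ d) (d : Fin S → ℂ) :
    sv S (firstRows U) * en (F *ᵥ d) ≤ en (firstRows F *ᵥ d) := by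
  have h := sv_mul_en_le hS (firstRows U) (Uᴴ *ᵥ (F *ᵥ d))
  rw [firstRows_mulVec, hUF, ← firstRows_mulVec] at h
  have e := en_isometry_mulVec hUU (Uᴴ *ᵥ (F *ᵥ d))
  rw [hUF] at e
  rwa [e]

/-- Uᴴ F is injective and square, so every c is Uᴴ F d, and U₀ c = F₀ d. -/
theorem sv_firstRows_pos {L S : ℕ} (hS : 1 ≤ S) {F U : Matrix (Fin (L + 1)) (Fin S) ℂ}
    (hUF : ∀ d, U *ᵥ (Uᴴ *ᵥ (F *ᵥ d)) = F *ᵥ d)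
    (hF : ∀ d, firstRows F *ᵥ d = 0 → d = 0) : 0 < sv S (firstRows U) := by
  refine sv_pos hS _ fun c hc => ?_
  have hinj : Function.Injective (Uᴴ * F).mulVecLin := by
    rw [injective_iff_map_eq_zero]
    intro d hd
    rw [mulVecLin_apply, ← mulVec_mulVec] at hd
    refine hF d ?_
    rw [firstRows_mulVec, ← hUF, hd, mulVec_zero]
    rfl
  obtain ⟨d, rfl⟩ := LinearMap.injective_iff_surjective.1 hinj c
  rw [mulVecLin_apply, ← mulVec_mulVec] at hc ⊢
  rw [firstRows_mulVec, hUF, ← firstRows_mulVec] at hc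
  rw [hF d hc, mulVec_zero, mulVec_zero]

/-- The columns of the left factor nearly lie in the span of the leading left singular vectors of a
perturbed product. -/
theorem IsLeadingLeftSingular.en_sub_proj_factor_le {m n S : ℕ} {N : Matrix (Fin m) (Fin n) ℂ}
    {F : Matrix (Fin m) (Fin S) ℂ} {B : Matrix (Fin S) (Fin n) ℂ} {U : Matrix (Fin m) (Fin S) ℂ}
    (hU : IsLeadingLeftSingular (F * B + N) U) {β : ℝ} (hβ : 0 < β)
    (hB : ∀ c, ∃ w, B *ᵥ w = c ∧ β * en w ≤ en c) (d : Fin S → ℂ) :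
    en (F *ᵥ d - U *ᵥ (Uᴴ *ᵥ (F *ᵥ d))) ≤ 2 * specNorm N / β * en d := by
  obtain ⟨w, rfl, hw⟩ := hB d
  have h1 := hU.en_residual_le rfl w
  have h2 := (en_sub_proj_le hU.conjTranspose_mul_self (N *ᵥ w)).trans (en_mulVec_le N w)
  -- The residual of F B is that of F B + N minus that of N; each is at most ‖N‖‖w‖, whence the
  -- factor 2.
  have e : F *ᵥ (B *ᵥ w) - U *ᵥ (Uᴴ *ᵥ (F *ᵥ (B *ᵥ w))) =
      ((F * B + N) *ᵥ w - U *ᵥ (Uᴴ *ᵥ ((F * B + N) *ᵥ w))) -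
        (N *ᵥ w - U *ᵥ (Uᴴ *ᵥ (N *ᵥ w))) := by
    simp only [add_mulVec, mulVec_add, mulVec_mulVec]
    abel
  rw [e]
  refine (en_sub_le _ _).trans ?_
  rw [div_mul_eq_mul_div, le_div_iff₀ hβ]
  nlinarith [mul_le_mul_of_nonneg_left hw (specNorm_nonneg N)]

/-- The eigenvalues computed by ESPRIT, matched with the points `e^{-2πiω_j}` through clusters of
discs. -/
theorem exists_perm_discGraph {L M S : ℕ} (hS : 1 ≤ S) (hSL : S ≤ L) (hLM : L + S ≤ M + 1)
    {x : Fin S → ℂ} {ω : Fin S → UnitAddCircle} (hx : ∀ j, x j ≠ 0) (hω : Function.Injective ω)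
    {η : Fin (M + 1) → ℂ} {σ₀ : ℝ} (hσ₀ : 0 < σ₀) (hσ₀1 : σ₀ ≤ 1)
    (hF₀ : ∀ d, σ₀ * en (vandermonde L ω *ᵥ d) ≤ en (firstRows (vandermonde L ω) *ᵥ d))
    (hN : 4 * specNorm (hankel L η) ≤
      minAmp x * sv S (vandermonde L ω) * sv S (vandermonde (M - L) ω) * σ₀)
    {Uhat : Matrix (Fin (L + 1)) (Fin S) ℂ} {ev : Fin S → ℂ}
    (hU : IsLeadingLeftSingular (hankel L (samples M x ω + η)) Uhat)
    (hev : (pinv (firstRows Uhat) * lastRows Uhat).charpoly.roots = Finset.univ.val.map ev) :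
    ∃ ψ : Equiv.Perm (Fin S), ∀ j, ∃ i,
      (discGraph (fun j => fourier (-1) (ω j)) (16 * specNorm (hankel L η) /
        (minAmp x * sv S (vandermonde L ω) * sv S (vandermonde (M - L) ω) * σ₀))).Reachable i j ∧
      ‖ev (ψ j) - fourier (-1) (ω i)‖ ≤ 16 * specNorm (hankel L η) /
        (minAmp x * sv S (vandermonde L ω) * sv S (vandermonde (M - L) ω) * σ₀) := by
  have hxm := minAmp_pos hS hx
  have hσ := sv_vandermonde_pos hS (by omega : S ≤ L + 1) hω
  have hσ' := sv_vandermonde_pos hS (by omega : S ≤ M - L + 1) hω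
  have hN0 := specNorm_nonneg (hankel L η)
  have hUhat := hU.conjTranspose_mul_self
  rw [hankel_add, hankel_samples (by omega)] at hU
  have hZ := hU.en_sub_proj_factor_le (mul_pos hxm hσ')
    (exists_diagonal_mul_transpose_mulVec_eq hS (by omega) hx hω)
  set ν := specNorm (hankel L η)
  set σ := sv S (vandermonde L ω)
  set σ' := sv S (vandermonde (M - L) ω)
  set a := minAmp x
  obtain ⟨E, hE, hEn⟩ := exists_charpoly_pinv_mul_eq (σ := σ) (σ₀ := σ₀)
    (τ := 2 * ν / (a * σ * σ')) (fun j => norm_fourier_apply (-1) (ω j))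
    (lastRows_vandermonde L ω) hσ (sv_mul_en_le hS _) hσ₀ hσ₀1 hF₀ hUhat (by positivity)
    (by
      rw [mul_div_assoc', div_le_iff₀ (by positivity)]
      linarith)
    (fun d => (hZ d).trans_eq (by field_simp))
  have hr : 8 * (2 * ν / (a * σ * σ')) / σ₀ = 16 * ν / (a * σ * σ' * σ₀) := by
    ring
  rw [hr] at hEn
  exact exists_perm_eigenvalues _ E (by positivity) hEn (hE ▸ hev)

end ESPRIT

end

/-! ### The two error bounds. -/

theorem theorem3p4 (L M S : ℕ) (hS : 1 ≤ S) (hSL : S ≤ L) (hLM : L + S ≤ M + 1)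
    -- the measure `μ = ∑ j, x_j δ_{ω_j}` with `S` distinct atoms and nonzero amplitudes
    (x : Fin S → ℂ) (ω : Fin S → UnitAddCircle) (hx : ∀ j, x j ≠ 0) (hω : Function.Injective ω)
    (η : Fin (M + 1) → ℂ)
    -- the left singular vectors of the noiseless Hankel matrix
    (U : Matrix (Fin (L + 1)) (Fin S) ℂ)
    (hU : ESPRIT.IsLeadingLeftSingular (ESPRIT.hankel L (ESPRIT.samples M x ω)) U)
    -- the output of ESPRIT on the noisy data
    (ωhat : Fin S → UnitAddCircle)
    (hωhat : ESPRIT.IsOutput L (ESPRIT.samples M x ω + η) ωhat) :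
    (ESPRIT.specNorm (ESPRIT.hankel L η) ≤
        ESPRIT.minAmp x * ESPRIT.sv S (ESPRIT.firstRows U) * ESPRIT.sv S (ESPRIT.vandermonde L ω) *
          ESPRIT.sv S (ESPRIT.vandermonde (M - L) ω) / (4 * Real.sqrt (2 * (S : ℝ))) →
      ESPRIT.matchingDist ω ωhat ≤
        20 * (S : ℝ) ^ 2 * Real.sqrt ((L : ℝ) + 1) * ESPRIT.specNorm (ESPRIT.hankel L η) /
          (ESPRIT.minAmp x * ESPRIT.sv S (ESPRIT.firstRows U) ^ 2 *
            ESPRIT.sv S (ESPRIT.vandermonde L ω) ^ 2 *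
            ESPRIT.sv S (ESPRIT.vandermonde (M - L) ω))) ∧
    (ENNReal.ofReal (ESPRIT.specNorm (ESPRIT.hankel L η)) ≤
        ESPRIT.minSep ω * ENNReal.ofReal
          (ESPRIT.minAmp x * ESPRIT.sv S (ESPRIT.firstRows U) ^ 2 *
            ESPRIT.sv S (ESPRIT.vandermonde L ω) ^ 3 *
            ESPRIT.sv S (ESPRIT.vandermonde (M - L) ω) /
              (20 * (S : ℝ) ^ (5 / 2 : ℝ) * ((L : ℝ) + 1))) →
      ESPRIT.matchingDist ω ωhat ≤
        20 * Real.sqrt (S : ℝ) * ESPRIT.specNorm (ESPRIT.hankel L η) /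
          (ESPRIT.minAmp x * ESPRIT.sv S (ESPRIT.firstRows U) ^ 2 *
            ESPRIT.sv S (ESPRIT.vandermonde L ω) *
            ESPRIT.sv S (ESPRIT.vandermonde (M - L) ω))) := by
  obtain ⟨Uhat, ev, hUhat, hev, hωev⟩ := hωhat
  have hUU := hU.conjTranspose_mul_self
  rw [ESPRIT.hankel_samples (by omega)] at hU
  have hUF := hU.mulVec_conjTranspose_mulVec fun c =>
    (ESPRIT.exists_diagonal_mul_transpose_mulVec_eq hS (by omega) hx hω c).imp fun _ h => h.1
  have hσ₀ : 0 < ESPRIT.sv S (ESPRIT.firstRows U) :=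
    ESPRIT.sv_firstRows_pos hS hUF fun d hd =>
      ESPRIT.eq_zero_of_vandermonde_mulVec hω (Nat.le_succ L) hSL fun k hk =>
        congrFun hd ⟨k, hk⟩
  have hσ₀1 := ESPRIT.sv_firstRows_le_one hS hUU
  have hmatch := ESPRIT.exists_perm_discGraph hS hSL hLM hx hω (η := η) hσ₀ hσ₀1
    (ESPRIT.sv_firstRows_mul_le hS hUU hUF) (ev := ev) (hU := hUhat) (hev := hev)
  have hdist (j k : Fin S) : dist (ωhat j) (ω k) ≤ 1 / 2 * ‖ev j - fourier (-1) (ω k)‖ := by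
    rw [hωev]
    exact ESPRIT.dist_arg_le _ _
  have ha := ESPRIT.minAmp_pos hS hx
  have hσ := ESPRIT.sv_vandermonde_pos hS (by omega : S ≤ L + 1) hω
  have hσ' := ESPRIT.sv_vandermonde_pos hS (by omega : S ≤ M - L + 1) hω
  have hσL := ESPRIT.sv_vandermonde_le hS L ω
  have hν := ESPRIT.specNorm_nonneg (ESPRIT.hankel L η)
  have hS1 : (1 : ℝ) ≤ S := by exact_mod_cast hS
  clear hωev hev hUhat hUF hU hUU
  generalize ESPRIT.specNorm (ESPRIT.hankel L η) = ν at *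
  generalize ESPRIT.sv S (ESPRIT.firstRows U) = σ₀ at *
  generalize ESPRIT.sv S (ESPRIT.vandermonde L ω) = σ at *
  generalize ESPRIT.sv S (ESPRIT.vandermonde (M - L) ω) = σ' at *
  generalize ESPRIT.minAmp x = a at *
  have hL0 : (0 : ℝ) ≤ L := Nat.cast_nonneg L
  set r := 16 * ν / (a * σ * σ' * σ₀) with hr
  have hr0 : 0 ≤ r := by positivity
  constructor
  · intro h
    have h4 : 4 * ν ≤ a * σ * σ' * σ₀ := by
      have hs : 1 ≤ Real.sqrt (2 * (S : ℝ)) := Real.one_le_sqrt.2 (by linarith)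
      rw [le_div_iff₀ (by positivity)] at h
      nlinarith
    obtain ⟨ψ, hψ⟩ := hmatch h4
    refine ESPRIT.matchingDist_le hS ψ fun j => ?_
    obtain ⟨i, hij, hi⟩ := hψ j
    have h1 : ‖ev (ψ j) - fourier (-1) (ω j)‖ ≤ r + 2 * r * (S - 1) :=
      (norm_sub_le_norm_sub_add_norm_sub _ (fourier (-1) (ω i)) _).trans
        (add_le_add hi (ESPRIT.norm_sub_le_of_reachable hr0 hij))
    -- The slack between S r and the claimed bound: σ₀ ≤ 1 and σ ≤ √(L+1).
    have h2 : 16 ≤ 20 * (S : ℝ) * Real.sqrt (L + 1) / (σ₀ * σ) := by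
      rw [le_div_iff₀ (by positivity)]
      have : σ₀ * σ ≤ 1 * Real.sqrt (L + 1) := mul_le_mul hσ₀1 hσL hσ.le zero_le_one
      nlinarith [Real.sqrt_nonneg ((L : ℝ) + 1)]
    calc dist (ωhat (ψ j)) (ω j) ≤ 1 / 2 * (r + 2 * r * (S - 1)) :=
          (hdist _ _).trans (by linarith)
      _ ≤ S * r := by nlinarith
      _ = S * ν / (a * σ * σ' * σ₀) * 16 := by rw [hr]; ring
      _ ≤ S * ν / (a * σ * σ' * σ₀) * (20 * (S : ℝ) * Real.sqrt (L + 1) / (σ₀ * σ)) :=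
          mul_le_mul_of_nonneg_left h2 (by positivity)
      _ = _ := by field_simp
  · intro h
    have hsS : 1 ≤ Real.sqrt (S : ℝ) := Real.one_le_sqrt.2 hS1
    by_cases h4 : 4 * ν ≤ a * σ * σ' * σ₀
    · obtain ⟨ψ, hψ⟩ := hmatch h4
      -- Meeting discs force Δ ≤ r, and the noise hypothesis then gives ν ≤ (4/5)ν. So ν = 0 and r =
      -- 0, and the two points coincide.
      have hsep {i j : Fin S}
          (hij : (ESPRIT.discGraph (fun j => fourier (-1) (ω j)) r).Adj i j) : False := by
        have hne : ω i ≠ ω j := hω.ne hij.1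
        have hd : dist (ω i) (ω j) ≤ r :=
          (ESPRIT.dist_le_half_norm_fourier_sub _ _).trans (by linarith [hij.2])
        have hc : 0 ≤ a * σ₀ ^ 2 * σ ^ 3 * σ' / (20 * (S : ℝ) ^ (5 / 2 : ℝ) * ((L : ℝ) + 1)) := by
          positivity
        have hmin : ESPRIT.minSep ω ≤ ENNReal.ofReal (dist (ω i) (ω j)) := by
          rw [← edist_dist]
          exact Set.einfsep_le_edist_of_mem (Set.mem_range_self i) (Set.mem_range_self j) hne
        have h1 := h.trans (mul_le_mul_left hmin _)
        rw [← ENNReal.ofReal_mul dist_nonneg, ENNReal.ofReal_le_ofReal_iff (by positivity)] at h1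
        have h2 := h1.trans (mul_le_mul_of_nonneg_right hd hc)
        have hp : 1 ≤ (S : ℝ) ^ (5 / 2 : ℝ) := Real.one_le_rpow hS1 (by norm_num)
        have hσ2 : σ ^ 2 ≤ L + 1 := by
          have := pow_le_pow_left₀ hσ.le hσL 2
          rwa [Real.sq_sqrt (by positivity)] at this
        have hq : σ₀ * σ ^ 2 / ((S : ℝ) ^ (5 / 2 : ℝ) * ((L : ℝ) + 1)) ≤ 1 := by
          rw [div_le_one (by positivity)]
          exact (mul_le_mul hσ₀1 hσ2 (by positivity) zero_le_one).trans
            (mul_le_mul_of_nonneg_right hp (by positivity))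
        have e : r * (a * σ₀ ^ 2 * σ ^ 3 * σ' / (20 * (S : ℝ) ^ (5 / 2 : ℝ) * ((L : ℝ) + 1))) =
            4 / 5 * ν * (σ₀ * σ ^ 2 / ((S : ℝ) ^ (5 / 2 : ℝ) * ((L : ℝ) + 1))) := by
          rw [hr]
          field_simp
          ring
        rw [e] at h2
        have hν0 : ν = 0 := by
          have := mul_le_mul_of_nonneg_left hq (by positivity : 0 ≤ 4 / 5 * ν)
          linarith
        have hrz : r = 0 := by rw [hr, hν0]; simp
        exact hne (dist_le_zero.1 (hrz ▸ hd))
      refine ESPRIT.matchingDist_le hS ψ fun j => ?_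
      obtain ⟨i, ⟨p⟩, hi⟩ := hψ j
      have hij : i = j := by
        cases p with
        | nil => rfl
        | cons hadj _ => exact (hsep hadj).elim
      subst hij
      calc dist (ωhat (ψ i)) (ω i) ≤ 1 / 2 * r := (hdist _ _).trans (by linarith)
        _ = ν / (a * σ * σ' * σ₀) * 8 := by rw [hr]; ring
        _ ≤ ν / (a * σ * σ' * σ₀) * (20 * Real.sqrt S / σ₀) := by
            refine mul_le_mul_of_nonneg_left ?_ (by positivity)
            rw [le_div_iff₀ hσ₀]
            linarith
        _ = _ := by field_simp
    -- For large noise the claimed bound is at least 5√S, so any permutation will do.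
    · refine ESPRIT.matchingDist_le hS 1 fun j => (ESPRIT.dist_unitAddCircle_le_half _ _).trans ?_
      push Not at h4
      rw [le_div_iff₀ (by positivity)]
      have h5 : a * σ₀ ^ 2 * σ * σ' ≤ 4 * ν := by
        have : a * σ * σ' * σ₀ * σ₀ ≤ a * σ * σ' * σ₀ * 1 :=
          mul_le_mul_of_nonneg_left hσ₀1 (by positivity)
        nlinarith
      nlinarith [mul_le_mul_of_nonneg_right hsS hν]
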